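/- Let $(\mathbb B,\|\cdot\|)$ be a separable real Banach space. For $1<r\le 2$, call $\mathbb B$ \emph{$r$-smooth} if there is an equivalent norm $\|\cdot\|'$ on $\mathbb B$ such that $$\sup_{t>0}\ \sup_{\|x\|'=\|y\|'=1}\frac{\|x+ty\|'+\|x-ty\|'-2}{t^r}<\infty .$$ For integers $n\ge m\ge 1$ let $\operatorname{Inc}_n^m$ be the set of $\boldsymbol i=(i_1,\dots,i_m)$ with $1\le i_1<\dots<i_m\le n$. For a sequence $(\xi_i)_{i\ge1}$ write $\xi_{\boldsymbol i}=(\xi_{i_1},\dots,\xi_{i_m})$ and, for $J\subseteq\{1,\dots,m\}$, $\xi_J=(\xi_j)_{j\in J}$ and $[m]=\{1,\dots,m\}$. For all $m\ge1$, $p>1$ and $q>0$ there is a constant $K=K(m,p,q,\mathbb B)\in(0,\infty)$, depending only on $m,p,q$ and $\mathbb B$, such that the following holds. Suppose that $\mathbb B$ is $r$-smooth for some $r\in(1,2]$ with $p\le r$. Let $(\xi_i)_{i\ge1}$ be an i.i.d. sequence of random variables with values in a measurable space $(S,\mathcal S)$, and let $h\colon S^m\to\mathbb B$ be a measurable function that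 is degenerated with respect to $(\xi_i)_{i\ge1}$, that is, $h(\xi_{[m]})$ is integrable and, for each $\ell_0\in[m]$, $$\mathbb E\big[h(\xi_{[m]})\mid \xi_{[m]\setminus\{\ell_0\}}\big]=0\quad\text{almost surely.}$$ Then for every $t>0$ and every integer $N\ge m$, $$\begin{aligned} \mathbb P\Big(\max_{m\le n\le N}\Big\|\sum_{\boldsymbol i\in\operatorname{Inc}_n^m}h(\xi_{\boldsymbol i})\Big\|>t\Big) \le{}& K\,N^m\int_0^1u^{q-1}\,\mathbb P\big(\|h(\xi_{[m]})\|>tu\big)\,du\\ &+K\sum_{\emptyset\subsetneq J\subsetneq[m]}N^{|J|}\int_0^1u^{q-1}\,\mathbb P\Big(N^{\frac{m-|J|}{p}}\big(\mathbb E\big[\|h(\xi_{[m]})\|^p\mid\xi_J\big]\big)^{1/p}>tu\Big)\,du\\ &+K\,t^{-q}N^{mq/p}\big(\mathbb E\|h(\xi_{[m]})\|^p\big)^{q/p}, \end{aligned}$$ where both sides are read in $[0,\infty]$ (the last term is $+\infty$ if $\mathbb E\|h(\xi_{[m]})\|^p=\infty$). -/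

import Mathlib

open MeasureTheory ProbabilityTheory
open scoped ENNReal NNReal

noncomputable section

/-- A real normed space is `r`-smooth if it carries an equivalent norm `ν` with
`sup_{t > 0} sup_{ν x = ν y = 1} (ν (x + t y) + ν (x - t y) - 2) / t ^ r < ∞`.
(A seminorm that is equivalent to the given norm is automatically a norm.) -/
def IsRSmooth (r : ℝ) (B : Type*) [NormedAddCommGroup B] [NormedSpace ℝ B] : Prop :=
  ∃ ν : Seminorm ℝ B,
    (∃ c C : ℝ, 0 < c ∧ 0 < C ∧ ∀ x : B, c * ‖x‖ ≤ ν x ∧ ν x ≤ C * ‖x‖) ∧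
    ∃ M : ℝ, ∀ t : ℝ, 0 < t → ∀ x y : B, ν x = 1 → ν y = 1 →
      (ν (x + t • y) + ν (x - t • y) - 2) / t ^ r ≤ M

/-- `ξ` is an i.i.d. sequence of `S`-valued random variables under `P`. -/
structure IsIID {Ω S : Type*} [MeasurableSpace Ω] [MeasurableSpace S]
    (P : Measure Ω) (ξ : ℕ → Ω → S) : Prop where
  measurable : ∀ i, Measurable (ξ i)
  indep : iIndepFun ξ P
  identDistrib : ∀ i, IdentDistrib (ξ i) (ξ 0) P P

/-- The random vector made of the first `m` terms of the sequence. Sequences are indexed from `0`,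
so the positions `0, …, m - 1` (the elements of `Fin m`) play the role of `1, …, m`. -/
def firstVars {Ω S : Type*} (m : ℕ) (ξ : ℕ → Ω → S) (ω : Ω) : Fin m → S :=
  fun l => ξ l ω

/-- The σ-algebra on `Ω` generated by the random vector `ξ_J = (ξ_j)_{j ∈ J}`. -/
abbrev sigmaOf {Ω S : Type*} [MeasurableSpace S] {m : ℕ} (ξ : ℕ → Ω → S) (J : Finset (Fin m)) :
    MeasurableSpace Ω :=
  MeasurableSpace.comap (fun (ω : Ω) (j : J) => ξ (j : Fin m) ω) MeasurableSpace.pi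

/-- The kernel `h` is degenerated with respect to `ξ`: the random variable `h (ξ_1, …, ξ_m)` is
integrable and its conditional expectation given all of `ξ_1, …, ξ_m` but any one is zero. -/
def IsDegenerated {Ω S B : Type*} [MeasurableSpace Ω] [MeasurableSpace S]
    [NormedAddCommGroup B] [NormedSpace ℝ B] [CompleteSpace B] {m : ℕ}
    (P : Measure Ω) (ξ : ℕ → Ω → S) (h : (Fin m → S) → B) : Prop :=
  Integrable (fun ω => h (firstVars m ξ ω)) P ∧
    ∀ l : Fin m, P[fun ω => h (firstVars m ξ ω) | sigmaOf ξ (Finset.univ \ {l})] =ᵐ[P] 0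

/-- The `U`-statistic of order `m` with kernel `h`: the sum of `h (ξ_{i_1}, …, ξ_{i_m})` over all
strictly increasing `m`-tuples of indices among the first `n`. -/
def uStat {Ω S B : Type*} [AddCommMonoid B] {m : ℕ}
    (ξ : ℕ → Ω → S) (h : (Fin m → S) → B) (n : ℕ) (ω : Ω) : B :=
  ∑ i : Fin m ↪o Fin n, h (fun l => ξ (i l) ω)

/-- `∫₀¹ u ^ (q - 1) * P (Y > t u) du` for a random variable `Y` with values in `[0, ∞]`. -/
def tailIntegral {Ω : Type*} [MeasurableSpace Ω] (P : Measure Ω) (Y : Ω → ℝ≥0∞) (q t : ℝ) :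
    ℝ≥0∞ :=
  ∫⁻ u in Set.Ioc (0 : ℝ) 1,
    ENNReal.ofReal (u ^ (q - 1)) * P {ω | ENNReal.ofReal (t * u) < Y ω}

end

set_option linter.unusedSectionVars false

noncomputable section

/-! ### Smoothness and the one-step moment inequality -/

/-! Smoothness supplies a convex gauge `φ`, comparable to `‖·‖ ^ p`, with `φ (x + y) + φ (x - y) ≤ 2
* φ x + C * ‖y‖ ^ p`. For a centred `g`, Jensen gives `φ s ≤ E φ (s - g)`, hence `E φ (s + g) ≤ φ s
+ C * E ‖g‖ ^ p` (`IsSmoothGauge.lintegral_add_le`). Summing over steps bounds the `p`-th moment of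
a martingale by its predictable variation.

Apply this to the increments lying between the first passages above `t` and `2 * t`, kept only while
the variation is at most `(δ * t) ^ p`. Chebyshev yields a good-`λ` inequality
(`IsSmoothGauge.good_lambda`): the probability of exceeding `2 * t` is at most `C * (2 * δ) ^ p`
times that of exceeding `t`, plus the probabilities that an increment exceeds `δ * t` or that the
variation exceeds `(δ * t) ^ p`.

A `U`-statistic of order `m + 1` is a martingale whose `k`-th increment is an order-`m` statistic of
the past with the last variable set to `ξ k`. A large increment is handled by freezing that
variable, which is independent of the past. The variation is at most `N` times the largest `p`-th
power of an `L^p` norm over the last variable, so it again concerns order-`m` statistics, now with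
the last variable as a parameter. Carrying a parameter `τ` and an `L^p` norm in `τ` through the
induction on `m` keeps the values in `B`, so smoothness is needed only for `B` itself.

The functional `tailBound`, a sum over subsets `J` of the variables, reproduces this dichotomy
exactly (`tailBound_succ`): sets containing the last index correspond to freezing, the others to
absorbing. It grows by at most `2 ^ q` when `t` is halved, so for small `δ` the good-`λ` inequality
can be iterated (`le_two_mul_of_recursive_le`). At the end `J = univ` gives the term in `‖h‖`, `J =
∅` the moment term, and the other sets the conditional moments. -/

/-- A gauge comparable to `‖·‖ ^ p` which is convex and satisfies a parallelogram-type
inequality with constant `C`. -/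
structure IsSmoothGauge {B : Type*} [NormedAddCommGroup B] [NormedSpace ℝ B]
    (p C : ℝ) (φ : B → ℝ) : Prop where
  const_pos : 0 < C
  continuous : Continuous φ
  convexOn : ConvexOn ℝ Set.univ φ
  map_zero : φ 0 = 0
  norm_rpow_le : ∀ x, ‖x‖ ^ p ≤ φ x
  le_norm_rpow : ∀ x, φ x ≤ C * ‖x‖ ^ p
  add_sub_le : ∀ x y, φ (x + y) + φ (x - y) ≤ 2 * φ x + C * ‖y‖ ^ p

/-- Bernoulli for the exponent `p - 1 ∈ [0, 1]`, multiplied by `1 + a`, leaves the quadratic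
coefficient `p - 1 ≤ 1`. -/
lemma one_add_rpow_le_quadratic {p a : ℝ} (hp : 1 ≤ p) (hp2 : p ≤ 2) (ha : -1 ≤ a) :
    (1 + a) ^ p ≤ 1 + p * a + a ^ 2 := by
  rcases eq_or_lt_of_le ha with rfl | ha'
  · norm_num
    rw [Real.zero_rpow (by linarith)]
    linarith
  have h1 : (1 + a) ^ p = (1 + a) * (1 + a) ^ (p - 1) := by
    rw [← Real.rpow_one_add' (by linarith) (by linarith)]
    ring_nf
  have h2 := rpow_one_add_le_one_add_mul_self ha (p := p - 1) (by linarith) (by linarith)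
  rw [h1]
  calc (1 + a) * (1 + a) ^ (p - 1) ≤ (1 + a) * (1 + (p - 1) * a) := by
        apply mul_le_mul_of_nonneg_left h2; linarith
    _ ≤ _ := by nlinarith [mul_nonneg (by linarith : 0 ≤ 2 - p) (sq_nonneg a)]

/-- The linear terms of the quadratic bound add up to `p * (a + b - 2)`, which `hab` controls; the
two squares are at most `t ^ 2 ≤ t ^ p`. -/
lemma rpow_add_rpow_le_of_smooth {p M t a b : ℝ} (hp : 1 ≤ p) (hp2 : p ≤ 2)
    (ht : 0 < t) (ht1 : t ≤ 1) (ha : |a - 1| ≤ t) (hb : |b - 1| ≤ t)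
    (hab : a + b - 2 ≤ M * t ^ p) :
    a ^ p + b ^ p ≤ 2 + (p * M + 2) * t ^ p := by
  have hsq : t ^ 2 ≤ t ^ p := by
    rw [← Real.rpow_natCast]
    exact Real.rpow_le_rpow_of_exponent_ge ht ht1 (by exact_mod_cast hp2)
  have key : ∀ c : ℝ, |c - 1| ≤ t → c ^ p ≤ 1 + p * (c - 1) + t ^ p := by
    intro c hc
    have h1 := one_add_rpow_le_quadratic (a := c - 1) hp hp2 (by have := abs_le.1 hc; linarith)
    have h2 : (c - 1) ^ 2 ≤ t ^ 2 := sq_le_sq' (by linarith [(abs_le.1 hc).1]) (abs_le.1 hc).2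
    rw [add_sub_cancel] at h1
    linarith
  have h1 := key a ha
  have h2 := key b hb
  have h3 : p * (a + b - 2) ≤ p * (M * t ^ p) := mul_le_mul_of_nonneg_left hab (by linarith)
  linarith

/-- If `ν x ≤ ν y`, the triangle inequality suffices: each term is at most `(2 * ν y) ^ p ≤ 4 * ν y
^ p`, whence the `8`. Otherwise, for `ν y ≠ 0`, homogeneity reduces to unit vectors and `t = ν y / ν
x ≤ 1`, where `t ^ r ≤ t ^ p`. -/
lemma Seminorm.rpow_add_rpow_sub_le {B : Type*} [NormedAddCommGroup B] [NormedSpace ℝ B]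
    (ν : Seminorm ℝ B) {p r M : ℝ} (hp : 1 < p) (hpr : p ≤ r) (hr : r ≤ 2)
    (hM : ∀ t : ℝ, 0 < t → ∀ x y : B, ν x = 1 → ν y = 1 →
      (ν (x + t • y) + ν (x - t • y) - 2) / t ^ r ≤ M) (x y : B) :
    ν (x + y) ^ p + ν (x - y) ^ p ≤ 2 * ν x ^ p + (p * |M| + 8) * ν y ^ p := by
  have hadd := map_add_le_add ν x y
  have hsub := map_sub_le_add ν x y
  have hx0 := apply_nonneg ν x
  have hy0 := apply_nonneg ν y
  have hpM : 0 ≤ p * |M| := by positivity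
  have hyp : 0 ≤ ν y ^ p := by positivity
  have hxp : 0 ≤ ν x ^ p := by positivity
  rcases le_or_gt (ν x) (ν y) with hxy | hxy
  · have h2 : (2 * ν y) ^ p ≤ 4 * ν y ^ p := by
      rw [Real.mul_rpow (by norm_num) hy0]
      gcongr
      calc (2 : ℝ) ^ p ≤ 2 ^ (2 : ℝ) :=
            Real.rpow_le_rpow_of_exponent_le (by norm_num) (by linarith)
        _ = 4 := by norm_num
    have h3 : ν (x + y) ^ p ≤ (2 * ν y) ^ p :=
      Real.rpow_le_rpow (apply_nonneg _ _) (by linarith) (by linarith)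
    have h4 : ν (x - y) ^ p ≤ (2 * ν y) ^ p :=
      Real.rpow_le_rpow (apply_nonneg _ _) (by linarith) (by linarith)
    nlinarith
  rcases eq_or_lt_of_le hy0 with hy | hy
  · have h3 : ν (x + y) ^ p ≤ ν x ^ p :=
      Real.rpow_le_rpow (apply_nonneg _ _) (by linarith) (by linarith)
    have h4 : ν (x - y) ^ p ≤ ν x ^ p :=
      Real.rpow_le_rpow (apply_nonneg _ _) (by linarith) (by linarith)
    nlinarith
  have hx : 0 < ν x := hy.trans hxy
  set t := ν y / ν x with ht_def
  have ht : 0 < t := by positivity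
  have ht1 : t ≤ 1 := by rw [ht_def, div_le_one hx]; exact hxy.le
  set u := (ν x)⁻¹ • x with hu
  set v := (ν y)⁻¹ • y with hv
  have hνu : ν u = 1 := by
    rw [hu, map_smul_eq_mul, Real.norm_of_nonneg (by positivity)]; field_simp
  have hνv : ν v = 1 := by
    rw [hv, map_smul_eq_mul, Real.norm_of_nonneg (by positivity)]; field_simp
  have hxu : x = ν x • u := by rw [hu, smul_smul, mul_inv_cancel₀ hx.ne', one_smul]
  have hyv : y = ν x • (t • v) := by
    rw [hv, smul_smul, smul_smul, ht_def]
    field_simp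
    simp
  have e1 : ν (x + y) = ν x * ν (u + t • v) := by
    conv_lhs => rw [hxu, hyv, ← smul_add, map_smul_eq_mul, Real.norm_of_nonneg hx0]
  have e2 : ν (x - y) = ν x * ν (u - t • v) := by
    conv_lhs => rw [hxu, hyv, ← smul_sub, map_smul_eq_mul, Real.norm_of_nonneg hx0]
  have e3 : ν y = ν x * t := by rw [ht_def]; field_simp
  have hνtv : ν (t • v) = t := by
    rw [map_smul_eq_mul, hνv, Real.norm_of_nonneg ht.le, mul_one]
  have ha : |ν (u + t • v) - 1| ≤ t := by
    have h1 := map_add_le_add ν u (t • v)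
    have h2 := map_sub_le_add ν (u + t • v) (t • v)
    rw [add_sub_cancel_right] at h2
    rw [abs_le]; constructor <;> linarith
  have hb : |ν (u - t • v) - 1| ≤ t := by
    have h1 := map_sub_le_add ν u (t • v)
    have h2 := map_add_le_add ν (u - t • v) (t • v)
    rw [sub_add_cancel] at h2
    rw [abs_le]; constructor <;> linarith
  have hab : ν (u + t • v) + ν (u - t • v) - 2 ≤ |M| * t ^ p := by
    have h1 := hM t ht u v hνu hνv
    rw [div_le_iff₀ (by positivity)] at h1
    have h2 : t ^ r ≤ t ^ p := Real.rpow_le_rpow_of_exponent_ge ht ht1 hpr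
    calc _ ≤ M * t ^ r := h1
      _ ≤ |M| * t ^ r := by gcongr; exact le_abs_self M
      _ ≤ _ := by gcongr
  have main := rpow_add_rpow_le_of_smooth hp.le (hpr.trans hr) ht ht1 ha hb hab
  rw [e1, e2, e3, Real.mul_rpow hx0 (apply_nonneg _ _), Real.mul_rpow hx0 (apply_nonneg _ _),
    Real.mul_rpow hx0 ht.le]
  have htp : 0 ≤ t ^ p := by positivity
  nlinarith [mul_le_mul_of_nonneg_left main hxp, mul_nonneg hxp htp]

/-- The gauge is `(ν x / c) ^ p`; dividing by `c` makes the lower comparison with `‖x‖ ^ p` hold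
with constant one. -/
lemma IsRSmooth.exists_isSmoothGauge {B : Type*} [NormedAddCommGroup B] [NormedSpace ℝ B]
    {p r : ℝ} (hp : 1 < p) (hpr : p ≤ r) (hr : r ≤ 2) (h : IsRSmooth r B) :
    ∃ (C : ℝ) (φ : B → ℝ), IsSmoothGauge p C φ := by
  obtain ⟨ν, ⟨c, C, hc, hC, hcC⟩, M, hM⟩ := h
  have hν : Continuous ν := by
    refine Seminorm.continuous_of_le (p := ν) (q := C.toNNReal • normSeminorm ℝ B) ?_ ?_
    · have : (⇑(C.toNNReal • normSeminorm ℝ B)) = fun x => C * ‖x‖ := by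
        ext x; simp [NNReal.smul_def, hC.le]
      rw [this]; fun_prop
    · intro x; simpa [NNReal.smul_def, hC.le] using (hcC x).2
  have hp0 : 0 ≤ p := by linarith
  set D := (p * |M| + 8) * (C / c) ^ p with hD
  have h0 : 0 ≤ (C / c) ^ p := by positivity
  have hup : ∀ x, (ν x / c) ^ p ≤ (C / c) ^ p * ‖x‖ ^ p := by
    intro x
    rw [← Real.mul_rpow (by positivity) (norm_nonneg x)]
    refine Real.rpow_le_rpow (div_nonneg (apply_nonneg _ _) hc.le) ?_ hp0
    rw [div_mul_eq_mul_div]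
    exact div_le_div_of_nonneg_right (hcC x).2 hc.le
  refine ⟨D, fun x => (ν x / c) ^ p, ⟨by positivity, ?_, ?_, ?_, ?_, ?_, ?_⟩⟩
  · exact (hν.div_const c).rpow_const fun x => Or.inr hp0
  · have h1 : ConvexOn ℝ Set.univ fun x => ν x / c := by
      have := ν.convexOn.smul (c := c⁻¹) (by positivity)
      refine this.congr fun x _ => ?_
      simp [div_eq_inv_mul]
    have h2 : ConvexOn ℝ (Set.Ici 0) fun x : ℝ => x ^ p := convexOn_rpow hp.le
    refine ⟨convex_univ, fun x _ y _ a b ha hb hab => ?_⟩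
    have hpos : ∀ x, 0 ≤ ν x / c := fun x => div_nonneg (apply_nonneg _ _) hc.le
    calc (ν (a • x + b • y) / c) ^ p ≤ (a • (ν x / c) + b • (ν y / c)) ^ p :=
          Real.rpow_le_rpow (hpos _) (h1.2 trivial trivial ha hb hab) hp0
      _ ≤ _ := h2.2 (hpos x) (hpos y) ha hb hab
  · simp [Real.zero_rpow (by linarith : p ≠ 0)]
  · intro x
    refine Real.rpow_le_rpow (norm_nonneg _) ?_ hp0
    rw [le_div_iff₀ hc, mul_comm]
    exact (hcC x).1
  · intro x
    refine (hup x).trans ?_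
    gcongr
    rw [hD]
    have : 0 ≤ p * |M| := by positivity
    nlinarith
  · intro x y
    have h1 := ν.rpow_add_rpow_sub_le hp hpr hr hM x y
    have h2 : ∀ z, (ν z / c) ^ p = ν z ^ p * (c ^ p)⁻¹ := fun z => by
      rw [Real.div_rpow (apply_nonneg _ _) hc.le, div_eq_mul_inv]
    have h3 : (0 : ℝ) ≤ (c ^ p)⁻¹ := by positivity
    have h4 : (p * |M| + 8) * (ν y / c) ^ p ≤ D * ‖y‖ ^ p := by
      rw [hD, mul_assoc]
      gcongr
      exact hup y
    have h5 := mul_le_mul_of_nonneg_right h1 h3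
    rw [h2 y] at h4
    simp only [h2]
    nlinarith

/-- The one-step moment inequality: adding a centred increment `g` to a fixed vector `s` increases
the gauge by at most a multiple of the `p`-th moment of `g`. -/
lemma IsSmoothGauge.lintegral_add_le {B : Type*} [NormedAddCommGroup B] [NormedSpace ℝ B]
    [CompleteSpace B] [TopologicalSpace.SeparableSpace B] [MeasurableSpace B] [BorelSpace B]
    {p C : ℝ} (hp : 1 < p) {φ : B → ℝ} (hφ : IsSmoothGauge p C φ)
    {S : Type*} [MeasurableSpace S] (μ : Measure S) [IsProbabilityMeasure μ]
    {g : S → B} (hg : Measurable g) (hg0 : ∫ x, g x ∂μ = 0) (s : B) :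
    ∫⁻ x, ENNReal.ofReal (φ (s + g x)) ∂μ ≤
      ENNReal.ofReal (φ s) + ENNReal.ofReal C * ∫⁻ x, ‖g x‖ₑ ^ p ∂μ := by
  have hC := hφ.const_pos
  have hφ0 : ∀ x, 0 ≤ φ x := fun x => (by positivity : 0 ≤ ‖x‖ ^ p).trans (hφ.norm_rpow_le x)
  have hgs : AEStronglyMeasurable g μ := hg.aestronglyMeasurable
  by_cases htop : ∫⁻ x, ‖g x‖ₑ ^ p ∂μ = ∞
  · rw [htop, ENNReal.mul_top (by simpa using hC)]
    simp
  have hmem : MemLp g (ENNReal.ofReal p) μ := by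
    refine ⟨hgs, ?_⟩
    rw [eLpNorm_lt_top_iff_lintegral_rpow_enorm_lt_top (by simp; linarith) (by simp),
      ENNReal.toReal_ofReal (by linarith)]
    exact lt_top_iff_ne_top.2 htop
  have hgi : Integrable g μ := hmem.integrable (by
    rw [← ENNReal.ofReal_one]; exact ENNReal.ofReal_le_ofReal hp.le)
  have hpow : ∀ f : S → B, MemLp f (ENNReal.ofReal p) μ → Integrable (fun x => ‖f x‖ ^ p) μ := by
    intro f hf
    have := hf.integrable_norm_rpow (by simp; linarith) (by simp)
    rwa [ENNReal.toReal_ofReal (by linarith)] at this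
  have hφi : ∀ f : S → B, MemLp f (ENNReal.ofReal p) μ → Integrable (fun x => φ (f x)) μ := by
    intro f hf
    refine Integrable.mono' ((hpow f hf).const_mul C)
      (hφ.continuous.comp_aestronglyMeasurable hf.1) ?_
    filter_upwards with x
    rw [Real.norm_of_nonneg (hφ0 _)]
    exact hφ.le_norm_rpow _
  have hadd := hφi (fun x => s + g x) ((memLp_const s).add hmem)
  have hsub := hφi (fun x => s - g x) ((memLp_const s).sub hmem)
  -- Since `s - g` has mean `s`, convexity bounds the minus term from below, so subtracting it from
  -- the parallelogram inequality leaves a single `φ s`.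
  have hjensen : φ s ≤ ∫ x, φ (s - g x) ∂μ := by
    have h1 := hφ.convexOn.map_integral_le (μ := μ) (f := fun x => s - g x)
      hφ.continuous.continuousOn isClosed_univ (by simp)
      ((integrable_const s).sub hgi) hsub
    rw [integral_sub (integrable_const s) hgi, hg0] at h1
    simpa using h1
  have hsum : ∫ x, φ (s + g x) ∂μ + ∫ x, φ (s - g x) ∂μ ≤
      2 * φ s + C * ∫ x, ‖g x‖ ^ p ∂μ := by
    rw [← integral_add hadd hsub, ← integral_const_mul]
    have h2 : ∫ _x : S, 2 * φ s ∂μ = 2 * φ s := by simp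
    rw [← h2, ← integral_add (integrable_const _) ((hpow g hmem).const_mul C)]
    exact integral_mono (hadd.add hsub) ((integrable_const _).add ((hpow g hmem).const_mul C))
      fun x => hφ.add_sub_le s (g x)
  have hfin : ∫ x, φ (s + g x) ∂μ ≤ φ s + C * ∫ x, ‖g x‖ ^ p ∂μ := by linarith
  rw [← ofReal_integral_eq_lintegral_ofReal hadd (ae_of_all _ fun x => hφ0 _)]
  have he : ∫⁻ x, ‖g x‖ₑ ^ p ∂μ = ENNReal.ofReal (∫ x, ‖g x‖ ^ p ∂μ) := by
    rw [ofReal_integral_eq_lintegral_ofReal (hpow g hmem) (ae_of_all _ fun x => by positivity)]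
    refine lintegral_congr fun x => ?_
    rw [← ofReal_norm, ENNReal.ofReal_rpow_of_nonneg (norm_nonneg _) (by linarith)]
  rw [he, ← ENNReal.ofReal_mul hC.le, ← ENNReal.ofReal_add (hφ0 _) (by positivity)]
  exact ENNReal.ofReal_le_ofReal hfin

/-! ### The past of an i.i.d. sequence -/

/-- The σ-algebra generated by the first `k` terms of the sequence. -/
abbrev pastSigma {Ω S : Type*} [MeasurableSpace S] (ξ : ℕ → Ω → S) (k : ℕ) : MeasurableSpace Ω :=
  ⨆ i ∈ Set.Iio k, MeasurableSpace.comap (ξ i) inferInstance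

section Past

variable {Ω S : Type*} [mΩ : MeasurableSpace Ω] [mS : MeasurableSpace S]
  {P : Measure Ω} {ξ : ℕ → Ω → S}

lemma measurable_pastSigma (ξ : ℕ → Ω → S) {i k : ℕ} (h : i < k) :
    Measurable[pastSigma ξ k] (ξ i) := by
  rw [measurable_iff_comap_le]
  exact le_iSup₂_of_le (f := fun i (_ : i ∈ Set.Iio k) => MeasurableSpace.comap (ξ i) mS) i h le_rfl

lemma pastSigma_mono (ξ : ℕ → Ω → S) : Monotone (pastSigma ξ) := fun _ _ h =>
  biSup_mono fun _ hi => lt_of_lt_of_le hi h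

lemma IsIID.pastSigma_le (hξ : IsIID P ξ) (k : ℕ) : pastSigma ξ k ≤ mΩ :=
  iSup₂_le fun i _ => (hξ.measurable i).comap_le

lemma IsIID.pastSigma_prod_le {α : Type*} [mα : MeasurableSpace α] (hξ : IsIID P ξ) (k : ℕ) :
    (pastSigma ξ k).prod mα ≤ mΩ.prod mα :=
  sup_le_sup (MeasurableSpace.comap_mono (hξ.pastSigma_le k)) le_rfl

lemma IsIID.indep_pastSigma [IsProbabilityMeasure P] (hξ : IsIID P ξ) (k : ℕ) :
    Indep (pastSigma ξ k) (MeasurableSpace.comap (ξ k) mS) P := by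
  have h := indep_iSup_of_disjoint (fun i => (hξ.measurable i).comap_le) hξ.indep
    (S := Set.Iio k) (T := {k}) (by simp)
  simpa [pastSigma] using h

lemma IsIID.map_eq (hξ : IsIID P ξ) (k : ℕ) : P.map (ξ k) = P.map (ξ 0) :=
  (hξ.identDistrib k).map_eq

/-- Integrating a function of two independent random elements amounts to integrating out one of
them first. -/
lemma lintegral_indepFun {Y : Type*} {mY : MeasurableSpace Y} [IsProbabilityMeasure P]
    {Z : Ω → Y} {X : Ω → S} (hZ : Measurable Z) (hX : Measurable X) (hind : IndepFun Z X P)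
    {G : Y → S → ℝ≥0∞} (hG : Measurable (Function.uncurry G)) :
    ∫⁻ ω, G (Z ω) (X ω) ∂P = ∫⁻ ω, ∫⁻ x, G (Z ω) x ∂(P.map X) ∂P := by
  have : IsProbabilityMeasure (P.map X) := Measure.isProbabilityMeasure_map hX.aemeasurable
  have hmap := (indepFun_iff_map_prod_eq_prod_map_map hZ.aemeasurable hX.aemeasurable).1 hind
  calc ∫⁻ ω, G (Z ω) (X ω) ∂P = ∫⁻ ω, Function.uncurry G (Z ω, X ω) ∂P := rfl
    _ = ∫⁻ z, Function.uncurry G z ∂(P.map fun ω => (Z ω, X ω)) :=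
        (lintegral_map hG (hZ.prodMk hX)).symm
    _ = ∫⁻ ω, ∫⁻ x, Function.uncurry G (Z ω, x) ∂(P.map X) ∂P := by
      rw [hmap, lintegral_prod _ hG.aemeasurable,
        lintegral_map (Measurable.lintegral_prod_right' hG) hZ]
    _ = _ := rfl

lemma measurable_lintegral_param {α T : Type*} {mα : MeasurableSpace α} {mT : MeasurableSpace T}
    {ν : Measure T} [SFinite ν] {f : α × T → ℝ≥0∞} (hf : Measurable f) :
    Measurable fun a => ∫⁻ τ, f (a, τ) ∂ν :=
  Measurable.lintegral_prod_right' hf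

/-- Integrating a function of a random element `X` and of an independent σ-algebra amounts to
integrating out `X` first. -/
lemma lintegral_indep {ℱ : MeasurableSpace Ω} {mΩ : MeasurableSpace Ω}
    {P : Measure Ω} [IsProbabilityMeasure P] (hℱ : ℱ ≤ mΩ) {X : Ω → S} (hX : Measurable X)
    (hind : Indep ℱ (MeasurableSpace.comap X mS) P) {G : Ω → S → ℝ≥0∞}
    (hG : Measurable[ℱ.prod mS] (Function.uncurry G)) :
    ∫⁻ ω, G ω (X ω) ∂P = ∫⁻ ω, ∫⁻ x, G ω x ∂(P.map X) ∂P := by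
  -- The role of `Z` is played by the identity, seen as a map onto `Ω` with the smaller σ-algebra
  -- `ℱ`.
  refine @lintegral_indepFun Ω S mΩ mS P Ω ℱ _ id X (measurable_id'' hℱ) hX ?_ G hG
  refine (@IndepFun_iff_Indep Ω Ω S mΩ ℱ mS id X P).2 ?_
  rwa [MeasurableSpace.comap_id]

end Past

/-! ### Moments of sums of martingale differences with an auxiliary parameter -/

section Moment

variable {Ω S T B : Type*} [mΩ : MeasurableSpace Ω] [mS : MeasurableSpace S]
  [mT : MeasurableSpace T]
  [NormedAddCommGroup B] [NormedSpace ℝ B] [CompleteSpace B]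
  [TopologicalSpace.SeparableSpace B] [MeasurableSpace B] [BorelSpace B]
  {P : Measure Ω} {ξ : ℕ → Ω → S} {ν : Measure T}

/-- `g` is predictable: its `k`-th term depends on `ω` through the first `k` variables only. -/
def DependsOnPast (ξ : ℕ → Ω → S) (g : ℕ → Ω → S → T → B) : Prop :=
  ∀ k, Measurable[(pastSigma ξ k).prod (mS.prod mT)] fun z : Ω × S × T => g k z.1 z.2.1 z.2.2

lemma DependsOnPast.measurable_apply {g : ℕ → Ω → S → T → B} (hg : DependsOnPast ξ g) (k : ℕ) :
    Measurable[(pastSigma ξ (k + 1)).prod mT] fun z : Ω × T => g k z.1 (ξ k z.1) z.2 := by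
  have h1 : @Measurable (Ω × T) (Ω × S × T) ((pastSigma ξ (k + 1)).prod mT)
      ((pastSigma ξ k).prod (mS.prod mT)) (fun z => (z.1, ξ k z.1, z.2)) := by
    refine Measurable.prodMk ?_ (Measurable.prodMk ?_ measurable_snd)
    · exact (measurable_id'' (pastSigma_mono ξ (Nat.le_succ k))).comp measurable_fst
    · exact (measurable_pastSigma ξ (Nat.lt_succ_self k)).comp measurable_fst
  exact (hg k).comp h1

lemma DependsOnPast.measurable_sum {g : ℕ → Ω → S → T → B} (hg : DependsOnPast ξ g) (n : ℕ) :
    Measurable[(pastSigma ξ n).prod mT]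
      fun z : Ω × T => ∑ k ∈ Finset.range n, g k z.1 (ξ k z.1) z.2 := by
  refine Finset.measurable_sum _ fun k hk => ?_
  refine (hg.measurable_apply k).mono ?_ le_rfl
  have : k + 1 ≤ n := by simpa [Nat.succ_le_iff] using hk
  exact sup_le_sup (MeasurableSpace.comap_mono (pastSigma_mono ξ this)) le_rfl

/-- The `p`-th moment of a sum of martingale differences is controlled by the sum of the
`p`-th moments. -/
lemma IsSmoothGauge.lintegral_sum_le [IsProbabilityMeasure P] [SFinite ν]
    {p C : ℝ} (hp : 1 < p) {φ : B → ℝ} (hφ : IsSmoothGauge p C φ)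
    (hξ : IsIID P ξ) {g : ℕ → Ω → S → T → B} (hg : DependsOnPast ξ g)
    (hg0 : ∀ k, ∀ᵐ z ∂(P.prod ν), ∫ x, g k z.1 x z.2 ∂(P.map (ξ 0)) = 0) (n : ℕ) :
    ∫⁻ ω, ∫⁻ τ, ENNReal.ofReal (φ (∑ k ∈ Finset.range n, g k ω (ξ k ω) τ)) ∂ν ∂P ≤
      ENNReal.ofReal C * ∑ k ∈ Finset.range n,
        ∫⁻ ω, ∫⁻ x, ∫⁻ τ, ‖g k ω x τ‖ₑ ^ p ∂ν ∂(P.map (ξ 0)) ∂P := by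
  have hprob : IsProbabilityMeasure (P.map (ξ 0)) :=
    Measure.isProbabilityMeasure_map (hξ.measurable 0).aemeasurable
  set μ := P.map (ξ 0) with hμ
  induction n with
  | zero => simp [hφ.map_zero]
  | succ n ih =>
    have hs := hg.measurable_sum n
    set s : Ω → T → B := fun ω τ => ∑ k ∈ Finset.range n, g k ω (ξ k ω) τ with hs_def
    have hφm : Measurable fun b : B => ENNReal.ofReal (φ b) :=
      ENNReal.measurable_ofReal.comp hφ.continuous.measurable
    have hsg : @Measurable ((Ω × S) × T) B (((pastSigma ξ n).prod mS).prod mT) _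
        (fun z => s z.1.1 z.2 + g n z.1.1 z.1.2 z.2) := by
      refine Measurable.add ?_ ?_
      · have h1 : @Measurable ((Ω × S) × T) (Ω × T) (((pastSigma ξ n).prod mS).prod mT)
          ((pastSigma ξ n).prod mT) (fun z => (z.1.1, z.2)) :=
          Measurable.prodMk (measurable_fst.comp measurable_fst) measurable_snd
        exact hs.comp h1
      · have h1 : @Measurable ((Ω × S) × T) (Ω × S × T) (((pastSigma ξ n).prod mS).prod mT)
          ((pastSigma ξ n).prod (mS.prod mT)) (fun z => (z.1.1, z.1.2, z.2)) :=
          Measurable.prodMk (measurable_fst.comp measurable_fst)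
            (Measurable.prodMk (measurable_snd.comp measurable_fst) measurable_snd)
        exact (hg n).comp h1
    have hs' : Measurable fun z : Ω × T => s z.1 z.2 := hs.mono (hξ.pastSigma_prod_le n) le_rfl
    have hg' : Measurable fun z : Ω × S × T => g n z.1 z.2.1 z.2.2 :=
      (hg n).mono (hξ.pastSigma_prod_le n) le_rfl
    have hfreeze := lintegral_indep (hξ.pastSigma_le n)
      (hξ.measurable n) (hξ.indep_pastSigma n)
      (G := fun ω x => ∫⁻ τ, ENNReal.ofReal (φ (s ω τ + g n ω x τ)) ∂ν)
      (measurable_lintegral_param (hφm.comp hsg))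
    rw [hξ.map_eq, ← hμ] at hfreeze
    have hgm : ∀ ω, Measurable fun z : S × T => g n ω z.1 z.2 := fun ω =>
      hg'.comp measurable_prodMk_left
    have hsm : ∀ ω, Measurable fun τ => s ω τ := fun ω => hs'.comp measurable_prodMk_left
    have hg0' := Measure.ae_ae_of_ae_prod (hg0 n)
    calc ∫⁻ ω, ∫⁻ τ, ENNReal.ofReal (φ (∑ k ∈ Finset.range (n + 1), g k ω (ξ k ω) τ)) ∂ν ∂P
        = ∫⁻ ω, ∫⁻ τ, ENNReal.ofReal (φ (s ω τ + g n ω (ξ n ω) τ)) ∂ν ∂P := by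
          simp only [Finset.sum_range_succ, hs_def]
      _ = ∫⁻ ω, ∫⁻ x, ∫⁻ τ, ENNReal.ofReal (φ (s ω τ + g n ω x τ)) ∂ν ∂μ ∂P := hfreeze
      -- With `ω` and `τ` fixed, `s ω τ` is a constant vector and the one-step inequality applies in
      -- `x`.
      _ = ∫⁻ ω, ∫⁻ τ, ∫⁻ x, ENNReal.ofReal (φ (s ω τ + g n ω x τ)) ∂μ ∂ν ∂P := by
          refine lintegral_congr fun ω => lintegral_lintegral_swap (Measurable.aemeasurable ?_)
          exact hφm.comp (((hsm ω).comp measurable_snd).add (hgm ω))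
      _ ≤ ∫⁻ ω, ∫⁻ τ, (ENNReal.ofReal (φ (s ω τ)) +
            ENNReal.ofReal C * ∫⁻ x, ‖g n ω x τ‖ₑ ^ p ∂μ) ∂ν ∂P := by
          refine lintegral_mono_ae ?_
          filter_upwards [hg0'] with ω hω
          refine lintegral_mono_ae ?_
          filter_upwards [hω] with τ hτ
          exact hφ.lintegral_add_le hp μ ((hgm ω).comp measurable_prodMk_right) hτ _
      _ = ∫⁻ ω, ∫⁻ τ, ENNReal.ofReal (φ (s ω τ)) ∂ν ∂P +
            ENNReal.ofReal C * ∫⁻ ω, ∫⁻ x, ∫⁻ τ, ‖g n ω x τ‖ₑ ^ p ∂ν ∂μ ∂P := by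
          have h1 : ∀ ω, ∫⁻ τ, (ENNReal.ofReal (φ (s ω τ)) +
              ENNReal.ofReal C * ∫⁻ x, ‖g n ω x τ‖ₑ ^ p ∂μ) ∂ν =
              ∫⁻ τ, ENNReal.ofReal (φ (s ω τ)) ∂ν +
              ENNReal.ofReal C * ∫⁻ x, ∫⁻ τ, ‖g n ω x τ‖ₑ ^ p ∂ν ∂μ := by
            intro ω
            rw [lintegral_add_left (show Measurable fun τ => ENNReal.ofReal (φ (s ω τ)) from
              hφm.comp (hsm ω)), lintegral_const_mul' _ _ (by simp)]
            congr 2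
            exact lintegral_lintegral_swap
              (((hgm ω).comp measurable_swap).enorm.pow_const p).aemeasurable
          simp only [h1]
          rw [lintegral_add_left, lintegral_const_mul' _ _ (by simp)]
          exact Measurable.lintegral_prod_right' (hφm.comp hs')
      _ ≤ _ := by
          rw [Finset.sum_range_succ, mul_add]
          gcongr

end Moment

/-! ### The good-`λ` inequality -/

/-- The `L^p` norm of a function with values in a normed group, as an extended nonnegative real. -/
def lpMass {T B : Type*} [MeasurableSpace T] [NormedAddCommGroup B] (p : ℝ) (ν : Measure T)
    (f : T → B) : ℝ≥0∞ :=
  (∫⁻ τ, ‖f τ‖ₑ ^ p ∂ν) ^ (1 / p)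

section LpMass

variable {T B : Type*} [mT : MeasurableSpace T] [NormedAddCommGroup B]
  [TopologicalSpace.SeparableSpace B] [MeasurableSpace B] [BorelSpace B] {ν : Measure T} {p : ℝ}

lemma lpMass_zero (hp : 1 < p) : lpMass p ν (fun _ => (0 : B)) = 0 := by
  have : 0 < p := by linarith
  simp [lpMass, this]

lemma lpMass_rpow (hp : 1 < p) (f : T → B) : lpMass p ν f ^ p = ∫⁻ τ, ‖f τ‖ₑ ^ p ∂ν := by
  rw [lpMass, ← ENNReal.rpow_mul, one_div_mul_cancel (by linarith), ENNReal.rpow_one]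

lemma lpMass_add_le (hp : 1 < p) {f g : T → B} (hf : Measurable f) (hg : Measurable g) :
    lpMass p ν (fun τ => f τ + g τ) ≤ lpMass p ν f + lpMass p ν g := by
  refine le_trans ?_
    (ENNReal.lintegral_Lp_add_le hf.enorm.aemeasurable hg.enorm.aemeasurable hp.le)
  refine ENNReal.rpow_le_rpow (lintegral_mono fun τ => ?_) (by positivity)
  exact ENNReal.rpow_le_rpow (enorm_add_le _ _) (by linarith)

/-- A path that crosses the level `2t` with small increments also has a large increment between
the first passages above `t` and above `2t`. -/
lemma le_add_lpMass_of_crossing (hp : 1 < p) {d : ℕ → T → B} (hd : ∀ k, Measurable (d k))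
    {t δ : ℝ≥0∞} {N : ℕ}
    (hN : ∃ n ≤ N, 2 * t < lpMass p ν fun τ => ∑ k ∈ Finset.range n, d k τ)
    (hδ : ∀ k < N, lpMass p ν (d k) ≤ δ) {e : ℕ → Prop} [DecidablePred e]
    (he : ∀ k < N, e k ↔
      (∃ j ≤ k, t < lpMass p ν fun τ => ∑ i ∈ Finset.range j, d i τ) ∧
      ∀ j ≤ k, lpMass p ν (fun τ => ∑ i ∈ Finset.range j, d i τ) ≤ 2 * t) :
    2 * t ≤ lpMass p ν (fun τ => ∑ k ∈ Finset.range N, if e k then d k τ else 0) + (t + δ) := by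
  set u : ℕ → T → B := fun n τ => ∑ k ∈ Finset.range n, d k τ with hu
  have hum : ∀ n, Measurable (u n) := fun n => Finset.measurable_sum _ fun k _ => hd k
  have hex2 : ∃ n, 2 * t < lpMass p ν (u n) := by
    obtain ⟨n, _, hn⟩ := hN; exact ⟨n, hn⟩
  have htt : t ≤ 2 * t := by rw [two_mul]; exact le_self_add
  have hex1 : ∃ n, t < lpMass p ν (u n) := by
    obtain ⟨n, hn⟩ := hex2; exact ⟨n, htt.trans_lt hn⟩
  set a := Nat.find hex1 with ha
  set b := Nat.find hex2 with hb
  have hau : t < lpMass p ν (u a) := Nat.find_spec hex1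
  have hbu : 2 * t < lpMass p ν (u b) := Nat.find_spec hex2
  have hab : a ≤ b := Nat.find_min' hex1 (htt.trans_lt hbu)
  have hbN : b ≤ N := by
    obtain ⟨n, hnN, hn⟩ := hN; exact (Nat.find_min' hex2 hn).trans hnN
  -- The empty sum has mass zero, so passage `a` has a predecessor, where the level `t` is not yet
  -- exceeded; the overshoot at `a` is then at most `δ`.
  have ha0 : a ≠ 0 := by
    intro h0
    rw [h0] at hau
    have : u 0 = fun _ => 0 := by ext; simp [hu]
    rw [this, lpMass_zero hp] at hau
    simp at hau
  obtain ⟨a', ha'⟩ := Nat.exists_eq_succ_of_ne_zero ha0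
  have hZa : lpMass p ν (u a) ≤ t + δ := by
    have h1 : u a = fun τ => u a' τ + d a' τ := by
      ext τ; rw [ha']; simp [hu, Finset.sum_range_succ]
    rw [h1]
    refine (lpMass_add_le hp (hum a') (hd a')).trans (add_le_add ?_ (hδ a' (by omega)))
    exact not_lt.1 (Nat.find_min hex1 (by omega : a' < a))
  have heq : ∀ τ, u b τ = (∑ k ∈ Finset.range N, if e k then d k τ else 0) + u a τ := by
    intro τ
    -- The condition `e k` says precisely `a ≤ k < b`.
    have h1 : ∑ k ∈ Finset.range N, (if e k then d k τ else 0) = ∑ k ∈ Finset.Ico a b, d k τ := by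
      rw [← Finset.sum_filter]
      refine Finset.sum_congr ?_ fun _ _ => rfl
      ext k
      simp only [Finset.mem_filter, Finset.mem_range, Finset.mem_Ico]
      constructor
      · rintro ⟨hk, hek⟩
        obtain ⟨⟨j, hjk, hj⟩, h2⟩ := (he k hk).1 hek
        refine ⟨(Nat.find_min' hex1 hj).trans hjk, ?_⟩
        by_contra hcon
        exact absurd hbu (not_lt.2 (h2 b (not_lt.1 hcon)))
      · rintro ⟨hak, hkb⟩
        refine ⟨by omega, (he k (by omega)).2 ⟨⟨a, hak, hau⟩, fun j hj => ?_⟩⟩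
        exact not_lt.1 (Nat.find_min hex2 (by omega : j < b))
    rw [h1, add_comm]
    exact (Finset.sum_range_add_sum_Ico (fun k => d k τ) hab).symm
  have hSm : Measurable fun τ => ∑ k ∈ Finset.range N, if e k then d k τ else 0 := by
    refine Finset.measurable_sum _ fun k _ => ?_
    by_cases hk : e k
    · simpa [hk] using hd k
    · simp [hk]
  calc 2 * t ≤ lpMass p ν (u b) := hbu.le
    _ = lpMass p ν (fun τ => (∑ k ∈ Finset.range N, if e k then d k τ else 0) + u a τ) := by
      congr 1; ext τ; exact heq τ
    _ ≤ _ := (lpMass_add_le hp hSm (hum a)).trans (by gcongr)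

end LpMass

/-- If the partial sums of `V` stay below `c` as long as `e` holds, then so does the sum of `V`
over the indices where `e` holds. -/
lemma sum_ite_le_of_partial_sum_le {N : ℕ} {V : ℕ → ℝ≥0∞} {c : ℝ≥0∞} {e : ℕ → Prop}
    [DecidablePred e] (h : ∀ k, e k → ∑ j ∈ Finset.range (k + 1), V j ≤ c) :
    ∑ k ∈ Finset.range N, (if e k then V k else 0) ≤ c := by
  induction N with
  | zero => simp
  | succ n ih =>
    by_cases hn : e n
    · refine le_trans (Finset.sum_le_sum fun k _ => ?_) (h n hn)
      split_ifs <;> simp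
    · simpa [Finset.sum_range_succ, hn] using ih

section GoodLambda

variable {Ω S T B : Type*} [mΩ : MeasurableSpace Ω] [mS : MeasurableSpace S]
  [mT : MeasurableSpace T]
  [NormedAddCommGroup B] [NormedSpace ℝ B] [CompleteSpace B]
  [TopologicalSpace.SeparableSpace B] [MeasurableSpace B] [BorelSpace B]
  {P : Measure Ω} {ξ : ℕ → Ω → S} {ν : Measure T}

lemma DependsOnPast.measurable_lpMass_sum [SFinite ν] {p : ℝ} {g : ℕ → Ω → S → T → B}
    (hg : DependsOnPast ξ g) (n : ℕ) :
    Measurable[pastSigma ξ n]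
      fun ω => lpMass p ν fun τ => ∑ k ∈ Finset.range n, g k ω (ξ k ω) τ :=
  (measurable_id.pow_const (1 / p)).comp (measurable_lintegral_param
    ((measurable_enorm.pow_const p).comp (hg.measurable_sum n)))

lemma DependsOnPast.measurable_lintegral_enorm [SFinite ν] {p : ℝ}
    {g : ℕ → Ω → S → T → B} (hg : DependsOnPast ξ g) (k : ℕ) :
    Measurable[(pastSigma ξ k).prod mS]
      fun z : Ω × S => ∫⁻ τ, ‖g k z.1 z.2 τ‖ₑ ^ p ∂ν := by
  have h1 : @Measurable ((Ω × S) × T) (Ω × S × T) (((pastSigma ξ k).prod mS).prod mT)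
      ((pastSigma ξ k).prod (mS.prod mT)) (fun z => (z.1.1, z.1.2, z.2)) :=
    Measurable.prodMk (measurable_fst.comp measurable_fst)
      (Measurable.prodMk (measurable_snd.comp measurable_fst) measurable_snd)
  exact measurable_lintegral_param ((measurable_enorm.pow_const p).comp ((hg k).comp h1))

lemma DependsOnPast.measurable_variation [SFinite ν] {μ : Measure S} [SFinite μ] {p : ℝ}
    {g : ℕ → Ω → S → T → B} (hg : DependsOnPast ξ g) (k : ℕ) :
    Measurable[pastSigma ξ k] fun ω => ∫⁻ x, ∫⁻ τ, ‖g k ω x τ‖ₑ ^ p ∂ν ∂μ :=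
  measurable_lintegral_param (hg.measurable_lintegral_enorm k)

lemma DependsOnPast.ite {g : ℕ → Ω → S → T → B} (hg : DependsOnPast ξ g) {E : ℕ → Set Ω}
    [∀ k ω, Decidable (ω ∈ E k)]
    (hE : ∀ k, MeasurableSet[pastSigma ξ k] (E k)) :
    DependsOnPast ξ fun k ω x τ => if ω ∈ E k then g k ω x τ else 0 := fun k =>
  Measurable.ite (measurable_fst (hE k)) (hg k) measurable_const

/-- The good-`λ` inequality for sums of martingale differences. -/
lemma IsSmoothGauge.good_lambda [IsProbabilityMeasure P] [SFinite ν]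
    {p C : ℝ} (hp : 1 < p) {φ : B → ℝ} (hφ : IsSmoothGauge p C φ)
    (hξ : IsIID P ξ) {g : ℕ → Ω → S → T → B} (hg : DependsOnPast ξ g)
    (hg0 : ∀ k, ∀ᵐ z ∂(P.prod ν), ∫ x, g k z.1 x z.2 ∂(P.map (ξ 0)) = 0)
    {t δ : ℝ≥0} (ht : t ≠ 0) (hδ : 2 * δ ≤ 1) (N : ℕ) :
    P {ω | ∃ n ≤ N, 2 * (t : ℝ≥0∞) <
        lpMass p ν fun τ => ∑ k ∈ Finset.range n, g k ω (ξ k ω) τ} ≤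
      ENNReal.ofReal C * (2 * δ) ^ p *
        P {ω | ∃ n ≤ N, (t : ℝ≥0∞) <
          lpMass p ν fun τ => ∑ k ∈ Finset.range n, g k ω (ξ k ω) τ} +
      (∑ k ∈ Finset.range N, P {ω | (δ * t : ℝ≥0∞) < lpMass p ν (g k ω (ξ k ω))} +
        P {ω | (δ * t : ℝ≥0∞) ^ p < ∑ k ∈ Finset.range N,
          ∫⁻ x, ∫⁻ τ, ‖g k ω x τ‖ₑ ^ p ∂ν ∂(P.map (ξ 0))}) := by
  classical
  have hp0 : 0 < p := by linarith
  have hprob : IsProbabilityMeasure (P.map (ξ 0)) :=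
    Measure.isProbabilityMeasure_map (hξ.measurable 0).aemeasurable
  set μ := P.map (ξ 0) with hμ
  set Z : ℕ → Ω → ℝ≥0∞ := fun n ω => lpMass p ν fun τ => ∑ k ∈ Finset.range n, g k ω (ξ k ω) τ
    with hZ
  set V : ℕ → Ω → ℝ≥0∞ := fun k ω => ∫⁻ x, ∫⁻ τ, ‖g k ω x τ‖ₑ ^ p ∂ν ∂μ with hV
  have hZm : ∀ j k, j ≤ k → Measurable[pastSigma ξ k] (Z j) := fun j k hjk =>
    (hg.measurable_lpMass_sum j).mono (pastSigma_mono ξ hjk) le_rfl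
  have hVm : ∀ j k, j ≤ k → Measurable[pastSigma ξ k] (V j) := fun j k hjk =>
    (hg.measurable_variation j).mono (pastSigma_mono ξ hjk) le_rfl
  have hexm : ∀ k, MeasurableSet[pastSigma ξ k] {ω | ∃ j ≤ k, (t : ℝ≥0∞) < Z j ω} := by
    intro k
    have : {ω | ∃ j ≤ k, (t : ℝ≥0∞) < Z j ω} = ⋃ j ∈ Set.Iic k, {ω | (t : ℝ≥0∞) < Z j ω} := by
      ext; simp
    rw [this]
    exact MeasurableSet.biUnion (Set.to_countable _) fun j hj =>
      measurableSet_lt measurable_const (hZm j k hj)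
  -- All three conditions are known before `ξ k` is revealed: `V k` has the new variable integrated
  -- out, so the variation may include step `k` itself. Truncation by `E` therefore preserves
  -- predictability and centring.
  set E : ℕ → Set Ω := fun k => {ω | ∃ j ≤ k, (t : ℝ≥0∞) < Z j ω} ∩
    {ω | ∀ j ≤ k, Z j ω ≤ 2 * t} ∩ {ω | ∑ j ∈ Finset.range (k + 1), V j ω ≤ (δ * t : ℝ≥0∞) ^ p}
    with hE
  have hEm : ∀ k, MeasurableSet[pastSigma ξ k] (E k) := by
    intro k
    refine ((hexm k).inter ?_).inter ?_
    · have : {ω | ∀ j ≤ k, Z j ω ≤ 2 * t} = ⋂ j ∈ Set.Iic k, {ω | Z j ω ≤ 2 * t} := by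
        ext; simp
      rw [this]
      exact MeasurableSet.biInter (Set.to_countable _) fun j hj =>
        measurableSet_le (hZm j k hj) measurable_const
    · refine measurableSet_le (Finset.measurable_sum _ fun j hj => hVm j k ?_) measurable_const
      simpa [Nat.lt_succ_iff] using hj
  set g' : ℕ → Ω → S → T → B := fun k ω x τ => if ω ∈ E k then g k ω x τ else 0 with hg'
  have hg'd : DependsOnPast ξ g' := hg.ite hEm
  have hg'0 : ∀ k, ∀ᵐ z ∂(P.prod ν), ∫ x, g' k z.1 x z.2 ∂μ = 0 := by
    intro k
    filter_upwards [hg0 k] with z hz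
    by_cases h : z.1 ∈ E k
    · simpa [hg', h] using hz
    · simp [hg', h]
  set A : Set Ω := {ω | ∃ n ≤ N, (t : ℝ≥0∞) < Z n ω} with hA
  have hAm : MeasurableSet A := hξ.pastSigma_le N _ (hexm N)
  set M : Ω → ℝ≥0∞ := fun ω => lpMass p ν fun τ => ∑ k ∈ Finset.range N, g' k ω (ξ k ω) τ with hM
  have hMm : Measurable M := (hg'd.measurable_lpMass_sum N).mono (hξ.pastSigma_le N) le_rfl
  -- Off `A` no increment is kept, and on `A` the kept variation is at most `(δ * t) ^ p`; this is
  -- where the factor `P A` arises.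
  have hmoment : ∫⁻ ω, M ω ^ p ∂P ≤ ENNReal.ofReal C * ((δ * t : ℝ≥0∞) ^ p * P A) := by
    calc ∫⁻ ω, M ω ^ p ∂P
        ≤ ∫⁻ ω, ∫⁻ τ, ENNReal.ofReal (φ (∑ k ∈ Finset.range N, g' k ω (ξ k ω) τ)) ∂ν ∂P := by
          refine lintegral_mono fun ω => ?_
          rw [hM, lpMass_rpow hp]
          refine lintegral_mono fun τ => ?_
          rw [← ofReal_norm, ENNReal.ofReal_rpow_of_nonneg (norm_nonneg _) hp0.le]
          exact ENNReal.ofReal_le_ofReal (hφ.norm_rpow_le _)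
      _ ≤ ENNReal.ofReal C * ∑ k ∈ Finset.range N,
            ∫⁻ ω, ∫⁻ x, ∫⁻ τ, ‖g' k ω x τ‖ₑ ^ p ∂ν ∂μ ∂P := hφ.lintegral_sum_le hp hξ hg'd hg'0 N
      _ ≤ ENNReal.ofReal C * ∫⁻ ω, A.indicator (fun _ => (δ * t : ℝ≥0∞) ^ p) ω ∂P := by
          gcongr
          rw [← lintegral_finsetSum _ fun k _ => (hg'd.measurable_variation k).mono
            (hξ.pastSigma_le k) le_rfl]
          refine lintegral_mono fun ω => ?_
          have h1 : ∀ k, ∫⁻ x, ∫⁻ τ, ‖g' k ω x τ‖ₑ ^ p ∂ν ∂μ = if ω ∈ E k then V k ω else 0 := by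
            intro k
            by_cases h : ω ∈ E k
            · simp [hg', h, hV]
            · simp [hg', h, hp0]
          simp only [h1]
          by_cases hω : ω ∈ A
          · rw [Set.indicator_of_mem hω]
            exact sum_ite_le_of_partial_sum_le (e := fun k => ω ∈ E k) fun k hk => hk.2
          · rw [Set.indicator_of_notMem hω]
            refine (Finset.sum_eq_zero fun k hk => if_neg fun hkE => hω ?_).le
            obtain ⟨j, hj, hjt⟩ := hkE.1.1
            exact ⟨j, hj.trans (Finset.mem_range.1 hk).le, hjt⟩
      _ = _ := by rw [lintegral_indicator hAm, setLIntegral_const]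
  have hcheb : ((t / 2 : ℝ≥0) : ℝ≥0∞) ^ p * P {ω | ((t / 2 : ℝ≥0) : ℝ≥0∞) ≤ M ω} ≤
      ENNReal.ofReal C * ((δ * t : ℝ≥0∞) ^ p * P A) := by
    refine le_trans ?_ hmoment
    refine le_trans ?_ (mul_meas_ge_le_lintegral (hMm.pow_const p)
      (((t / 2 : ℝ≥0) : ℝ≥0∞) ^ p))
    gcongr _ * P ?_
    intro ω hω
    exact ENNReal.rpow_le_rpow hω hp0.le
  have hgood : P {ω | ((t / 2 : ℝ≥0) : ℝ≥0∞) ≤ M ω} ≤ ENNReal.ofReal C * (2 * δ) ^ p * P A := by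
    have ht2 : ((t / 2 : ℝ≥0) : ℝ≥0∞) ^ p ≠ 0 := by
      simp [ENNReal.rpow_eq_zero_iff, ht, hp0.le]
    have ht2' : ((t / 2 : ℝ≥0) : ℝ≥0∞) ^ p ≠ ∞ :=
      ENNReal.rpow_ne_top_of_nonneg hp0.le ENNReal.coe_ne_top
    rw [← ENNReal.mul_le_mul_iff_right ht2 ht2']
    refine hcheb.trans (le_of_eq ?_)
    -- Comparing `δ * t` with the Chebyshev level `t / 2` produces the factor `2 * δ`.
    have h2 : (δ * t : ℝ≥0∞) = (2 * δ) * ((t / 2 : ℝ≥0) : ℝ≥0∞) := by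
      norm_cast
      field_simp
    rw [h2, ENNReal.mul_rpow_of_nonneg _ _ hp0.le]
    ring
  have hsub : {ω | ∃ n ≤ N, 2 * (t : ℝ≥0∞) < Z n ω} ⊆
      {ω | ((t / 2 : ℝ≥0) : ℝ≥0∞) ≤ M ω} ∪
      ((⋃ k ∈ Finset.range N, {ω | (δ * t : ℝ≥0∞) < lpMass p ν (g k ω (ξ k ω))}) ∪
        {ω | (δ * t : ℝ≥0∞) ^ p < ∑ k ∈ Finset.range N, V k ω}) := by
    intro ω hω
    by_contra hcon
    simp only [Set.mem_union, Set.mem_iUnion, Set.mem_ofPred_eq, not_or, not_exists, not_lt,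
      not_le, Finset.mem_range] at hcon
    obtain ⟨h1, h2, h3⟩ := hcon
    have hd : ∀ k, Measurable (g k ω (ξ k ω)) := fun k =>
      ((hg.measurable_apply k).mono (hξ.pastSigma_prod_le _) le_rfl).comp measurable_prodMk_left
    have key := le_add_lpMass_of_crossing hp hd hω (fun k hk => h2 k hk)
      (e := fun k => ω ∈ E k) (by
        intro k hk
        -- Off the bad events the total variation is small, so the third condition in `E k` is
        -- automatic and only the crossing conditions remain.
        refine ⟨fun h => ⟨h.1.1, h.1.2⟩, fun h => ⟨⟨h.1, h.2⟩, le_trans ?_ h3⟩⟩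
        exact Finset.sum_le_sum_of_subset (Finset.range_mono hk))
    have hlt : lpMass p ν (fun τ => ∑ k ∈ Finset.range N, if ω ∈ E k then g k ω (ξ k ω) τ else 0)
        + (t + δ * t) < 2 * t := by
      calc _ < ((t / 2 : ℝ≥0) : ℝ≥0∞) + (t + δ * t) :=
            ENNReal.add_lt_add_right (by finiteness) h1
        _ ≤ 2 * t := by
          norm_cast
          have : (δ : ℝ) * t ≤ t / 2 := by
            have h4 : 2 * (δ : ℝ) ≤ 1 := by exact_mod_cast hδ
            nlinarith [t.coe_nonneg]
          rw [← NNReal.coe_le_coe]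
          push_cast
          linarith
    exact absurd key (not_le.2 hlt)
  refine (measure_mono hsub).trans ((measure_union_le _ _).trans (add_le_add hgood ?_))
  refine (measure_union_le _ _).trans (add_le_add ?_ le_rfl)
  exact measure_biUnion_finset_le _ _

end GoodLambda

/-! ### The recursion for `U`-statistics -/

section Combinatorics

/-- Extend an order embedding by sending the last point to the last point. -/
def Fin.snocOrderEmb {m n : ℕ} (i : Fin m ↪o Fin n) : Fin (m + 1) ↪o Fin (n + 1) :=
  OrderEmbedding.ofStrictMono
    (Fin.snoc (α := fun _ => Fin (n + 1)) (fun l => (i l).castSucc) (Fin.last n)) (by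
      intro a b hab
      induction b using Fin.lastCases with
      | last =>
        obtain ⟨a, rfl⟩ := Fin.exists_castSucc_eq.2 hab.ne
        simp [Fin.castSucc_lt_last]
      | cast b =>
        obtain ⟨a, rfl⟩ := Fin.exists_castSucc_eq.2 (hab.trans (Fin.castSucc_lt_last b)).ne
        simpa using hab)

lemma Fin.snocOrderEmb_castSucc {m n : ℕ} (i : Fin m ↪o Fin n) (l : Fin m) :
    Fin.snocOrderEmb i l.castSucc = (i l).castSucc :=
  Fin.snoc_castSucc (α := fun _ => Fin (n + 1)) (Fin.last n) (fun l => (i l).castSucc) l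

lemma Fin.snocOrderEmb_last {m n : ℕ} (i : Fin m ↪o Fin n) :
    Fin.snocOrderEmb i (Fin.last m) = Fin.last n :=
  Fin.snoc_last (α := fun _ => Fin (n + 1)) (Fin.last n) (fun l => (i l).castSucc)

/-- An increasing tuple either avoids the largest index or, by monotonicity, takes it at its last
position only. -/
lemma Fin.bijective_orderEmb_succ (m n : ℕ) :
    Function.Bijective (Sum.elim (fun i : Fin (m + 1) ↪o Fin n => i.trans Fin.castSuccOrderEmb)
      (Fin.snocOrderEmb (m := m) (n := n))) := by
  constructor
  · rintro (i | i) (j | j) hij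
    · congr 1
      ext l
      have := DFunLike.congr_fun hij l
      simpa [Fin.ext_iff] using this
    · have := DFunLike.congr_fun hij (Fin.last m)
      simp only [Sum.elim_inl, Sum.elim_inr, Fin.snocOrderEmb_last] at this
      exact absurd this (Fin.castSucc_lt_last _).ne
    · have := DFunLike.congr_fun hij (Fin.last m)
      simp only [Sum.elim_inl, Sum.elim_inr, Fin.snocOrderEmb_last] at this
      exact absurd this.symm (Fin.castSucc_lt_last _).ne
    · congr 1
      ext l
      have := DFunLike.congr_fun hij l.castSucc
      simpa [Fin.snocOrderEmb_castSucc, Fin.ext_iff] using this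
  · intro j
    by_cases hj : j (Fin.last m) = Fin.last n
    · have hlt : ∀ l : Fin m, j l.castSucc ≠ Fin.last n := fun l h => by
        have := j.injective (h.trans hj.symm)
        exact absurd this (Fin.castSucc_lt_last l).ne
      refine ⟨Sum.inr (OrderEmbedding.ofStrictMono
        (fun l => (j l.castSucc).castPred (hlt l)) ?_), ?_⟩
      · intro a b hab
        simpa using hab
      · ext l
        induction l using Fin.lastCases with
        | last => simp [Fin.snocOrderEmb_last, hj]
        | cast l =>
          simp only [Sum.elim_inr, Fin.snocOrderEmb_castSucc]
          rfl
    · have hlt : ∀ l, j l ≠ Fin.last n := fun l h => by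
        have h1 : j l ≤ j (Fin.last m) := j.map_rel_iff.2 (Fin.le_last l)
        rw [h] at h1
        exact hj (le_antisymm (Fin.le_last _) h1)
      refine ⟨Sum.inl (OrderEmbedding.ofStrictMono (fun l => (j l).castPred (hlt l)) ?_), ?_⟩
      · intro a b hab
        simpa using hab
      · ext l
        rfl

/-- The tuples that use the new index end with it, so they form a statistic of one order less with
its last variable frozen at `ξ n`. -/
lemma uStat_succ {Ω S B : Type*} [AddCommMonoid B] {m : ℕ} (ξ : ℕ → Ω → S)
    (h : (Fin (m + 1) → S) → B) (n : ℕ) (ω : Ω) :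
    uStat ξ h (n + 1) ω =
      uStat ξ h n ω + uStat ξ (fun y => h (Fin.snoc (α := fun _ => S) y (ξ n ω))) n ω := by
  simp only [uStat]
  rw [← (Fin.bijective_orderEmb_succ m n).sum_comp, Fintype.sum_sum_type]
  congr 1
  refine Finset.sum_congr rfl fun i _ => ?_
  congr 1
  ext l
  induction l using Fin.lastCases with
  | last => simp [Fin.snocOrderEmb_last]
  | cast l => simp [Fin.snocOrderEmb_castSucc]

lemma uStat_eq_sum_range {Ω S B : Type*} [AddCommMonoid B] {m : ℕ} (ξ : ℕ → Ω → S)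
    (h : (Fin (m + 1) → S) → B) (n : ℕ) (ω : Ω) :
    uStat ξ h n ω = ∑ k ∈ Finset.range n,
      uStat ξ (fun y => h (Fin.snoc (α := fun _ => S) y (ξ k ω))) k ω := by
  induction n with
  | zero =>
    have : IsEmpty (Fin (m + 1) ↪o Fin 0) := ⟨fun i => (i 0).elim0⟩
    simp [uStat]
  | succ n ih => rw [uStat_succ, ih, Finset.sum_range_succ]

lemma uStat_order_zero {Ω S B : Type*} [AddCommMonoid B] (ξ : ℕ → Ω → S)
    (h : (Fin 0 → S) → B) (n : ℕ) (ω : Ω) (y : Fin 0 → S) : uStat ξ h n ω = h y := by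
  have : Unique (Fin 0 ↪o Fin n) :=
    ⟨⟨OrderEmbedding.ofStrictMono Fin.elim0 fun a => a.elim0⟩, fun i => by ext l; exact l.elim0⟩
  rw [uStat, Fintype.sum_unique]
  congr 1
  exact Subsingleton.elim _ _

/-- Subsets of `Fin (m + 1)` are split according to whether they contain the last point. -/
lemma sum_finset_fin_succ {M : Type*} [AddCommMonoid M] {m : ℕ} (f : Finset (Fin (m + 1)) → M) :
    ∑ J, f J = ∑ J : Finset (Fin m), f (J.map Fin.castSuccEmb) +
      ∑ J : Finset (Fin m), f (insert (Fin.last m) (J.map Fin.castSuccEmb)) := by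
  have h1 : (Finset.univ : Finset (Finset (Fin (m + 1)))) =
      (insert (Fin.last m) (Finset.univ.map Fin.castSuccEmb)).powerset := by
    rw [← Finset.powerset_univ]
    congr 1
    ext l
    induction l using Fin.lastCases <;> simp
  have h2 : ∀ F : Finset (Fin (m + 1)) → M,
      ∑ J ∈ (Finset.univ.map (Fin.castSuccEmb (n := m))).powerset, F J =
        ∑ J : Finset (Fin m), F (J.map Fin.castSuccEmb) := by
    intro F
    symm
    refine Finset.sum_bij (fun J _ => J.map Fin.castSuccEmb) ?_ ?_ ?_ ?_
    · intro J _
      simp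
    · intro J _ J' _ h
      exact Finset.map_injective _ h
    · intro J hJ
      obtain ⟨u, _, hu⟩ := Finset.subset_map_iff.1 (Finset.mem_powerset.1 hJ)
      exact ⟨u, Finset.mem_univ _, hu.symm⟩
    · intros; rfl
  rw [h1, Finset.sum_powerset_insert (by simp), h2, h2]

end Combinatorics

/-! ### Product measures -/

section Product

variable {S : Type*} [mS : MeasurableSpace S] {μ : Measure S} [IsProbabilityMeasure μ]

lemma measurable_snoc (m : ℕ) :
    Measurable fun z : (Fin m → S) × S => Fin.snoc (α := fun _ => S) z.1 z.2 := by
  refine measurable_pi_iff.2 fun l => ?_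
  induction l using Fin.lastCases with
  | last => simpa using measurable_snd
  | cast l => simpa using (measurable_pi_apply l).fun_comp measurable_fst

lemma measurePreserving_snoc (m : ℕ) :
    MeasurePreserving (fun z : (Fin m → S) × S => Fin.snoc (α := fun _ => S) z.1 z.2)
      ((Measure.pi fun _ => μ).prod μ) (Measure.pi fun _ => μ) := by
  refine ⟨measurable_snoc m, (Measure.pi_eq fun s hs => ?_).symm⟩
  rw [Measure.map_apply (measurable_snoc m) (MeasurableSet.univ_pi hs)]
  have : (fun z : (Fin m → S) × S => Fin.snoc (α := fun _ => S) z.1 z.2) ⁻¹' Set.univ.pi s =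
      (Set.univ.pi fun l => s (Fin.castSucc l)) ×ˢ s (Fin.last m) := by
    ext z
    simp only [Set.mem_preimage, Set.mem_univ_pi, Set.mem_prod, Fin.forall_fin_succ',
      Fin.snoc_castSucc, Fin.snoc_last]
  rw [this, Measure.prod_prod, Measure.pi_pi, Fin.prod_univ_castSucc]

lemma measurable_piecewise {ι : Type*} [DecidableEq ι] (J : Finset ι) :
    Measurable fun z : (ι → S) × (ι → S) => J.piecewise z.1 z.2 := by
  refine measurable_pi_iff.2 fun l => ?_
  by_cases hl : l ∈ J
  · simpa [hl] using (measurable_pi_apply l).fun_comp measurable_fst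
  · simpa [hl] using (measurable_pi_apply l).fun_comp measurable_snd

/-- Resampling the coordinates outside `J` from an independent copy keeps the law. This is what
identifies conditional expectations given `ξ_J` with partial integrals. -/
lemma measurePreserving_piecewise {ι : Type*} [Fintype ι] [DecidableEq ι] (J : Finset ι) :
    MeasurePreserving (fun z : (ι → S) × (ι → S) => J.piecewise z.1 z.2)
      ((Measure.pi fun _ => μ).prod (Measure.pi fun _ => μ)) (Measure.pi fun _ => μ) := by
  refine ⟨measurable_piecewise J, (Measure.pi_eq fun s hs => ?_).symm⟩
  rw [Measure.map_apply (measurable_piecewise J) (MeasurableSet.univ_pi hs)]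
  have : (fun z : (ι → S) × (ι → S) => J.piecewise z.1 z.2) ⁻¹' Set.univ.pi s =
      (Set.univ.pi fun l => if l ∈ J then s l else Set.univ) ×ˢ
        (Set.univ.pi fun l => if l ∈ J then Set.univ else s l) := by
    ext z
    simp only [Set.mem_preimage, Set.mem_univ_pi, Set.mem_prod, ← forall_and]
    refine forall_congr' fun l => ?_
    by_cases hl : l ∈ J <;> simp [hl]
  rw [this, Measure.prod_prod, Measure.pi_pi, Measure.pi_pi, ← Finset.prod_mul_distrib]
  refine Finset.prod_congr rfl fun l _ => ?_
  by_cases hl : l ∈ J <;> simp [hl]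

lemma measurable_update_pair {ι : Type*} [DecidableEq ι] (l : ι) :
    Measurable fun z : (ι → S) × S => Function.update z.1 l z.2 := by
  refine measurable_pi_iff.2 fun k => ?_
  by_cases hk : k = l
  · subst hk; simpa using measurable_snd
  · simpa [hk] using (measurable_pi_apply k).fun_comp measurable_fst

lemma measurePreserving_update {ι : Type*} [Fintype ι] [DecidableEq ι] (l : ι) :
    MeasurePreserving (fun z : (ι → S) × S => Function.update z.1 l z.2)
      ((Measure.pi fun _ => μ).prod μ) (Measure.pi fun _ => μ) := by
  refine ⟨measurable_update_pair l, (Measure.pi_eq fun s hs => ?_).symm⟩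
  rw [Measure.map_apply (measurable_update_pair l) (MeasurableSet.univ_pi hs)]
  have : (fun z : (ι → S) × S => Function.update z.1 l z.2) ⁻¹' Set.univ.pi s =
      (Set.univ.pi fun k => if k = l then Set.univ else s k) ×ˢ s l := by
    ext z
    simp only [Set.mem_preimage, Set.mem_univ_pi, Set.mem_prod]
    constructor
    · intro h
      refine ⟨fun k => ?_, by simpa using h l⟩
      by_cases hk : k = l
      · simp [hk]
      · simpa [hk] using h k
    · rintro ⟨h1, h2⟩ k
      by_cases hk : k = l
      · subst hk; simpa using h2
      · simpa [hk] using h1 k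
  rw [this, Measure.prod_prod, Measure.pi_pi, ← Finset.prod_erase_mul _ _ (Finset.mem_univ l),
    ← Finset.prod_erase_mul _ (fun i => μ (s i)) (Finset.mem_univ l)]
  simp only [if_true, measure_univ, mul_one]
  congr 1
  refine Finset.prod_congr rfl fun k hk => ?_
  rw [if_neg (Finset.ne_of_mem_erase hk)]

variable {T : Type*} [mT : MeasurableSpace T] {ν : Measure T} [IsProbabilityMeasure ν]

lemma measurePreserving_snoc_assoc (m : ℕ) :
    MeasurePreserving
      (fun z : (Fin m → S) × S × T =>
        ((Fin.snoc (α := fun _ => S) z.1 z.2.1 : Fin (m + 1) → S), z.2.2))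
      ((Measure.pi fun _ => μ).prod (μ.prod ν)) ((Measure.pi fun _ => μ).prod ν) := by
  have h1 := (measurePreserving_prodAssoc (Measure.pi fun _ : Fin m => μ) μ ν).symm
  exact ((measurePreserving_snoc (μ := μ) m).prod (MeasurePreserving.id ν)).comp h1

lemma measurePreserving_snoc_left (m : ℕ) :
    MeasurePreserving
      (fun z : S × (Fin m → S) × T =>
        ((Fin.snoc (α := fun _ => S) z.2.1 z.1 : Fin (m + 1) → S), z.2.2))
      (μ.prod ((Measure.pi fun _ => μ).prod ν)) ((Measure.pi fun _ => μ).prod ν) := by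
  have h1 := (measurePreserving_prodAssoc μ (Measure.pi fun _ : Fin m => μ) ν).symm
  have h2 : MeasurePreserving Prod.swap (μ.prod (Measure.pi fun _ : Fin m => μ))
    ((Measure.pi fun _ : Fin m => μ).prod μ) := Measure.measurePreserving_swap
  exact (((measurePreserving_snoc (μ := μ) m).comp h2).prod (MeasurePreserving.id ν)).comp h1

end Product

section IID

variable {Ω S : Type*} [MeasurableSpace Ω] [MeasurableSpace S] {P : Measure Ω}
  [IsProbabilityMeasure P] {ξ : ℕ → Ω → S}

lemma IsIID.measurePreserving_of_injective (hξ : IsIID P ξ) {m : ℕ} {i : Fin m → ℕ}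
    (hi : Function.Injective i) :
    MeasurePreserving (fun ω l => ξ (i l) ω) P (Measure.pi fun _ => P.map (ξ 0)) := by
  refine ⟨measurable_pi_iff.2 fun l => hξ.measurable _, ?_⟩
  have h1 := (iIndepFun_iff_map_fun_eq_pi_map
    (fun l => (hξ.measurable (i l)).aemeasurable)).1 (hξ.indep.precomp hi)
  rw [h1]
  congr 1
  ext1 l
  exact hξ.map_eq _

end IID

/-! ### Tail integrals -/

section Tail

variable {Ω : Type*} [MeasurableSpace Ω] {P : Measure Ω}

/-- Substituting `c * u` for `u` costs `c ^ (1 - q)` from the weight and `c⁻¹` from Lebesgue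
measure; its range `(0, c]` stays inside `(0, 1]`. -/
lemma tailIntegral_mul_le (Y : Ω → ℝ≥0∞) {q t c : ℝ} (hc : 0 < c) (hc1 : c ≤ 1) :
    tailIntegral P Y q (c * t) ≤ ENNReal.ofReal (c ^ (-q)) * tailIntegral P Y q t := by
  set F : ℝ → ℝ≥0∞ := (Set.Ioc (0 : ℝ) 1).indicator
    fun u => ENNReal.ofReal (u ^ (q - 1)) * P {ω | ENNReal.ofReal (t * u) < Y ω} with hF
  have hFint : tailIntegral P Y q t = ∫⁻ u, F u := by
    rw [hF, lintegral_indicator measurableSet_Ioc]; rfl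
  have hscale : ∫⁻ u, F (c * u) = ENNReal.ofReal c⁻¹ * ∫⁻ u, F u := by
    have h1 := lintegral_map_equiv (μ := volume) F (MeasurableEquiv.mulLeft₀ c hc.ne')
    have h2 : Measure.map (MeasurableEquiv.mulLeft₀ c hc.ne') volume =
        ENNReal.ofReal |c⁻¹| • (volume : Measure ℝ) := Real.map_volume_mul_left hc.ne'
    rw [h2, lintegral_smul_measure, abs_of_pos (by positivity)] at h1
    exact h1.symm
  have hpt : ∀ u ∈ Set.Ioc (0 : ℝ) 1,
      ENNReal.ofReal (u ^ (q - 1)) * P {ω | ENNReal.ofReal (c * t * u) < Y ω} =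
        ENNReal.ofReal (c ^ (1 - q)) * F (c * u) := by
    intro u hu
    have hcu : c * u ∈ Set.Ioc (0 : ℝ) 1 :=
      ⟨mul_pos hc hu.1, mul_le_one₀ hc1 hu.1.le hu.2⟩
    rw [hF, Set.indicator_of_mem hcu, ← mul_assoc, ← ENNReal.ofReal_mul (by positivity),
      Real.mul_rpow hc.le hu.1.le, ← mul_assoc, ← Real.rpow_add hc]
    have : c * t * u = t * (c * u) := by ring
    simp [this]
  calc tailIntegral P Y q (c * t)
      = ∫⁻ u in Set.Ioc (0 : ℝ) 1, ENNReal.ofReal (c ^ (1 - q)) * F (c * u) :=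
        setLIntegral_congr_fun measurableSet_Ioc hpt
    _ ≤ ∫⁻ u, ENNReal.ofReal (c ^ (1 - q)) * F (c * u) := setLIntegral_le_lintegral _ _
    _ = ENNReal.ofReal (c ^ (1 - q)) * (ENNReal.ofReal c⁻¹ * ∫⁻ u, F u) := by
        rw [lintegral_const_mul' _ _ (by simp), hscale]
    _ = _ := by
        rw [hFint, ← mul_assoc, ← ENNReal.ofReal_mul (by positivity), ← Real.rpow_neg_one c,
          ← Real.rpow_add hc]
        ring_nf

lemma setLIntegral_Ioc_rpow {q a : ℝ} (hq : 0 < q) (ha : 0 ≤ a) :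
    ∫⁻ u in Set.Ioc (0 : ℝ) a, ENNReal.ofReal (u ^ (q - 1)) = ENNReal.ofReal (a ^ q / q) := by
  have hint : IntervalIntegrable (fun u : ℝ => u ^ (q - 1)) volume 0 a :=
    intervalIntegral.intervalIntegrable_rpow' (by linarith)
  rw [← ofReal_integral_eq_lintegral_ofReal ((intervalIntegrable_iff_integrableOn_Ioc_of_le ha).1
      hint), ← intervalIntegral.integral_of_le ha, integral_rpow (Or.inl (by linarith))]
  · simp [Real.zero_rpow hq.ne']
  · exact (ae_restrict_iff' measurableSet_Ioc).2 (ae_of_all _ fun u hu =>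
      Real.rpow_nonneg hu.1.le _)

lemma one_le_mul_tailIntegral [IsProbabilityMeasure P] {Y : Ω → ℝ≥0∞} {q t : ℝ} (hq : 0 < q)
    (ht : 0 < t) (hY : ∀ ω, ENNReal.ofReal t < Y ω) :
    1 ≤ ENNReal.ofReal q * tailIntegral P Y q t := by
  have h1 : tailIntegral P Y q t = ∫⁻ u in Set.Ioc (0 : ℝ) 1, ENNReal.ofReal (u ^ (q - 1)) := by
    refine setLIntegral_congr_fun measurableSet_Ioc fun u hu => ?_
    have h2 : {ω | ENNReal.ofReal (t * u) < Y ω} = Set.univ := by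
      refine Set.eq_univ_of_forall fun ω => lt_of_le_of_lt (ENNReal.ofReal_le_ofReal ?_) (hY ω)
      exact mul_le_of_le_one_right ht.le hu.2
    simp [h2]
  rw [h1, setLIntegral_Ioc_rpow hq zero_le_one, ← ENNReal.ofReal_mul hq.le]
  simp [hq.ne']

/-- For a deterministic value the integrand vanishes once `u ≥ A / t`, and the weight integrates to
`(A / t) ^ q / q` up to there. -/
lemma tailIntegral_const_le [IsProbabilityMeasure P] (A : ℝ≥0∞) {q t : ℝ} (hq : 0 < q)
    (ht : 0 < t) :
    tailIntegral P (fun _ => A) q t ≤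
      ENNReal.ofReal (1 / q) * (ENNReal.ofReal (t ^ (-q)) * A ^ q) := by
  by_cases hA : A = ∞
  · rw [hA, ENNReal.top_rpow_of_pos hq, ENNReal.mul_top, ENNReal.mul_top]
    · exact le_top
    · simpa using hq
    · simpa using Real.rpow_pos_of_pos ht _
  lift A to ℝ≥0 using hA
  have hsub : ∀ u ∈ Set.Ioc (0 : ℝ) 1,
      ENNReal.ofReal (u ^ (q - 1)) * P {ω : Ω | ENNReal.ofReal (t * u) < (A : ℝ≥0∞)} ≤
        (Set.Ioc (0 : ℝ) (A / t)).indicator (fun u => ENNReal.ofReal (u ^ (q - 1))) u := by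
    intro u hu
    by_cases h : ENNReal.ofReal (t * u) < (A : ℝ≥0∞)
    · have hu' : u ∈ Set.Ioc (0 : ℝ) (A / t) := by
        refine ⟨hu.1, ?_⟩
        rw [le_div_iff₀ ht, mul_comm]
        have := (ENNReal.ofReal_lt_iff_lt_toReal (mul_pos ht hu.1).le (by simp)).1 h
        simpa using this.le
      rw [Set.indicator_of_mem hu']
      exact mul_le_of_le_one_right' prob_le_one
    · simp [h]
  calc tailIntegral P (fun _ => (A : ℝ≥0∞)) q t
      ≤ ∫⁻ u in Set.Ioc (0 : ℝ) 1,
          (Set.Ioc (0 : ℝ) (A / t)).indicator (fun u => ENNReal.ofReal (u ^ (q - 1))) u :=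
        setLIntegral_mono' measurableSet_Ioc hsub
    _ ≤ ∫⁻ u, (Set.Ioc (0 : ℝ) (A / t)).indicator (fun u => ENNReal.ofReal (u ^ (q - 1))) u :=
        setLIntegral_le_lintegral _ _
    _ = ENNReal.ofReal ((A / t : ℝ) ^ q / q) := by
        rw [lintegral_indicator measurableSet_Ioc, setLIntegral_Ioc_rpow hq (by positivity)]
    _ = _ := by
        have hAe : (A : ℝ≥0∞) = ENNReal.ofReal (A : ℝ) := by simp
        rw [hAe, ENNReal.ofReal_rpow_of_nonneg (by positivity) hq.le,
          ← ENNReal.ofReal_mul (by positivity), ← ENNReal.ofReal_mul (by positivity),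
          Real.div_rpow (by positivity) ht.le, Real.rpow_neg ht.le]
        congr 1
        field_simp

lemma tailIntegral_comp {Ω' : Type*} [MeasurableSpace Ω'] {P' : Measure Ω'} {X : Ω → Ω'}
    (hX : MeasurePreserving X P P') {Y : Ω' → ℝ≥0∞} (hY : Measurable Y) (q t : ℝ) :
    tailIntegral P (fun ω => Y (X ω)) q t = tailIntegral P' Y q t := by
  refine lintegral_congr fun u => ?_
  congr 1
  exact hX.measure_preimage (measurableSet_lt measurable_const hY).nullMeasurableSet

lemma tailIntegral_congr_ae {Y Y' : Ω → ℝ≥0∞} (h : Y =ᵐ[P] Y') (q t : ℝ) :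
    tailIntegral P Y q t = tailIntegral P Y' q t := by
  refine lintegral_congr fun u => ?_
  congr 1
  refine measure_congr ?_
  filter_upwards [h] with ω hω
  change (_ < _) = (_ < _)
  rw [hω]

section Param

variable {S : Type*} [MeasurableSpace S] {μ : Measure S} [SFinite μ] [SFinite P]
  {Y : S × Ω → ℝ≥0∞}

lemma measurable_tailIntegral_integrand (hY : Measurable Y) (q t : ℝ) :
    Measurable fun z : S × ℝ =>
      ENNReal.ofReal (z.2 ^ (q - 1)) * P {ω | ENNReal.ofReal (t * z.2) < Y (z.1, ω)} := by
  have hset : MeasurableSet {z : (S × ℝ) × Ω | ENNReal.ofReal (t * z.1.2) < Y (z.1.1, z.2)} :=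
    measurableSet_lt (by fun_prop) (hY.comp (by fun_prop))
  exact Measurable.mul (by fun_prop) (measurable_measure_prodMk_left hset)

lemma measurable_tailIntegral (hY : Measurable Y) (q t : ℝ) :
    Measurable fun x => tailIntegral P (fun ω => Y (x, ω)) q t :=
  measurable_lintegral_param (measurable_tailIntegral_integrand hY q t)

lemma lintegral_tailIntegral (hY : Measurable Y) (q t : ℝ) :
    ∫⁻ x, tailIntegral P (fun ω => Y (x, ω)) q t ∂μ = tailIntegral (μ.prod P) Y q t := by
  simp only [tailIntegral]
  rw [lintegral_lintegral_swap (measurable_tailIntegral_integrand hY q t).aemeasurable]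
  refine lintegral_congr fun u => ?_
  rw [lintegral_const_mul' _ _ (by simp),
    Measure.prod_apply (measurableSet_lt measurable_const hY)]
  rfl

end Param

lemma tailIntegral_const_mul {a : ℝ} (ha : 0 < a) (Y : Ω → ℝ≥0∞) (q t : ℝ) :
    tailIntegral P (fun ω => ENNReal.ofReal a * Y ω) q t = tailIntegral P Y q (t * a⁻¹) := by
  refine lintegral_congr fun u => ?_
  congr 2
  ext ω
  have h1 : ENNReal.ofReal (t * u) = ENNReal.ofReal a * ENNReal.ofReal (t * a⁻¹ * u) := by
    rw [← ENNReal.ofReal_mul ha.le]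
    congr 1
    field_simp
  rw [Set.mem_ofPred_eq, Set.mem_ofPred_eq, h1,
    ENNReal.mul_lt_mul_iff_right (by simpa using ha) (by simp)]

end Tail

/-! ### The tail functional of a kernel -/

section Kernel

variable {S T B : Type*} [mS : MeasurableSpace S] [mT : MeasurableSpace T]
  [NormedAddCommGroup B] [NormedSpace ℝ B]
  [TopologicalSpace.SeparableSpace B] [MeasurableSpace B] [BorelSpace B]

/-- The kernel obtained by freezing the last variable. -/
def freezeLast {m : ℕ} (h : (Fin (m + 1) → S) → T → B) (x : S) : (Fin m → S) → T → B :=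
  fun y τ => h (Fin.snoc (α := fun _ => S) y x) τ

/-- The kernel obtained by moving the last variable to the parameter space. -/
def absorbLast {m : ℕ} (h : (Fin (m + 1) → S) → T → B) : (Fin m → S) → S × T → B :=
  fun y z => h (Fin.snoc (α := fun _ => S) y z.1) z.2

/-- The conditional `L^p` norm of the kernel `h` given the variables with index in `J`. -/
def condMass {m : ℕ} (p : ℝ) (μ : Measure S) (ν : Measure T) (h : (Fin m → S) → T → B)
    (J : Finset (Fin m)) (y : Fin m → S) : ℝ≥0∞ :=
  (∫⁻ z, ∫⁻ τ, ‖h (J.piecewise y z) τ‖ₑ ^ p ∂ν ∂(Measure.pi fun _ => μ)) ^ (1 / p)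

/-- The functional which bounds the tail of the `U`-statistic with kernel `h`. -/
def tailBound {m : ℕ} (p q : ℝ) (μ : Measure S) (ν : Measure T) (h : (Fin m → S) → T → B)
    (N : ℕ) (t : ℝ) : ℝ≥0∞ :=
  ∑ J : Finset (Fin m), (N : ℝ≥0∞) ^ J.card *
    tailIntegral (Measure.pi fun _ => μ)
      (fun y => (N : ℝ≥0∞) ^ (((m : ℝ) - (J.card : ℝ)) / p) * condMass p μ ν h J y) q t

/-- Degenerate kernels: the integral over any one of the variables exists and vanishes. -/
def DegenerateKernel {m : ℕ} (μ : Measure S) (ν : Measure T) (h : (Fin m → S) → T → B) : Prop :=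
  ∀ l, ∀ᵐ z ∂((Measure.pi fun _ => μ).prod ν),
    Integrable (fun x => h (Function.update z.1 l x) z.2) μ ∧
      ∫ x, h (Function.update z.1 l x) z.2 ∂μ = 0

variable {μ : Measure S} [IsProbabilityMeasure μ] {ν : Measure T} [IsProbabilityMeasure ν]
  {p q : ℝ} {m : ℕ}

lemma tailBound_mul_le (h : (Fin m → S) → T → B) (N : ℕ) {t c : ℝ} (hc : 0 < c) (hc1 : c ≤ 1) :
    tailBound p q μ ν h N (c * t) ≤ ENNReal.ofReal (c ^ (-q)) * tailBound p q μ ν h N t := by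
  simp only [tailBound, Finset.mul_sum]
  refine Finset.sum_le_sum fun J _ => ?_
  rw [mul_left_comm]
  gcongr
  exact tailIntegral_mul_le _ hc hc1

lemma measurable_freezeLast {h : (Fin (m + 1) → S) → T → B} (hh : Measurable (Function.uncurry h)) :
    Measurable fun z : S × (Fin m → S) × T => freezeLast h z.1 z.2.1 z.2.2 :=
  hh.comp (((measurable_snoc m).comp
    ((measurable_fst.comp measurable_snd).prodMk measurable_fst)).prodMk
      (measurable_snd.comp measurable_snd))

lemma measurable_uncurry_freezeLast {h : (Fin (m + 1) → S) → T → B}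
    (hh : Measurable (Function.uncurry h)) (x : S) :
    Measurable (Function.uncurry (freezeLast h x)) :=
  (measurable_freezeLast hh).comp measurable_prodMk_left

lemma measurable_absorbLast {h : (Fin (m + 1) → S) → T → B} (hh : Measurable (Function.uncurry h)) :
    Measurable (Function.uncurry (absorbLast h)) :=
  hh.comp (((measurable_snoc m).comp
    (measurable_fst.prodMk (measurable_fst.comp measurable_snd))).prodMk
      (measurable_snd.comp measurable_snd))

lemma measurable_condMass {h : (Fin m → S) → T → B} (hh : Measurable (Function.uncurry h))
    (J : Finset (Fin m)) : Measurable (condMass p μ ν h J) := by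
  have h1 : Measurable fun z : ((Fin m → S) × (Fin m → S)) × T =>
      ‖h (J.piecewise z.1.1 z.1.2) z.2‖ₑ ^ p :=
    (hh.comp (((measurable_piecewise J).comp measurable_fst).prodMk measurable_snd)).enorm.pow_const p
  exact (measurable_lintegral_param (measurable_lintegral_param h1)).pow_const _

lemma piecewise_insert_last_snoc (J : Finset (Fin m)) (y z : Fin m → S) (x w : S) :
    (insert (Fin.last m) (J.map Fin.castSuccEmb)).piecewise
      (Fin.snoc (α := fun _ => S) y x) (Fin.snoc (α := fun _ => S) z w) =
      Fin.snoc (α := fun _ => S) (J.piecewise y z) x := by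
  ext l
  induction l using Fin.lastCases with
  | last => simp [Finset.piecewise]
  | cast l => simp [Finset.piecewise]

lemma piecewise_map_castSucc_snoc (J : Finset (Fin m)) (y z : Fin m → S) (x w : S) :
    (J.map Fin.castSuccEmb).piecewise
      (Fin.snoc (α := fun _ => S) y x) (Fin.snoc (α := fun _ => S) z w) =
      Fin.snoc (α := fun _ => S) (J.piecewise y z) w := by
  ext l
  induction l using Fin.lastCases with
  | last => simp [Finset.piecewise]
  | cast l => simp [Finset.piecewise]

lemma lintegral_pi_succ {F : (Fin (m + 1) → S) → ℝ≥0∞} (hF : Measurable F) :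
    ∫⁻ z, F z ∂(Measure.pi fun _ => μ) =
      ∫⁻ z, ∫⁻ w, F (Fin.snoc (α := fun _ => S) z w) ∂μ ∂(Measure.pi fun _ => μ) := by
  rw [← (measurePreserving_snoc (μ := μ) m).lintegral_comp hF,
    lintegral_prod (fun z : (Fin m → S) × S => F (Fin.snoc (α := fun _ => S) z.1 z.2))
      (hF.comp (measurable_snoc m)).aemeasurable]

/-- The last variable is conditioned on, so its resampled copy drops out of the integrand and
integrates to one. -/
lemma condMass_insert_last {h : (Fin (m + 1) → S) → T → B} (hh : Measurable (Function.uncurry h))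
    (J : Finset (Fin m)) (y : Fin m → S) (x : S) :
    condMass p μ ν h (insert (Fin.last m) (J.map Fin.castSuccEmb))
      (Fin.snoc (α := fun _ => S) y x) = condMass p μ ν (freezeLast h x) J y := by
  have hF : ∀ J y, Measurable fun z => ∫⁻ τ, ‖h (Finset.piecewise J y z) τ‖ₑ ^ p ∂ν := fun J y =>
    measurable_lintegral_param ((hh.comp (((measurable_piecewise J).comp (measurable_prodMk_left
      (x := y))).comp measurable_fst |>.prodMk measurable_snd)).enorm.pow_const p)
  rw [condMass, lintegral_pi_succ (hF _ _)]
  simp [piecewise_insert_last_snoc, condMass, freezeLast]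

/-- Here the last variable is integrated out, exactly as the parameter is, so the two merge into one
parameter and `x` plays no role. -/
lemma condMass_map_castSucc {h : (Fin (m + 1) → S) → T → B} (hh : Measurable (Function.uncurry h))
    (J : Finset (Fin m)) (y : Fin m → S) (x : S) :
    condMass p μ ν h (J.map Fin.castSuccEmb) (Fin.snoc (α := fun _ => S) y x) =
      condMass p μ (μ.prod ν) (absorbLast h) J y := by
  have hF : ∀ J y, Measurable fun z => ∫⁻ τ, ‖h (Finset.piecewise J y z) τ‖ₑ ^ p ∂ν := fun J y =>
    measurable_lintegral_param ((hh.comp (((measurable_piecewise J).comp (measurable_prodMk_left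
      (x := y))).comp measurable_fst |>.prodMk measurable_snd)).enorm.pow_const p)
  rw [condMass, lintegral_pi_succ (hF _ _), condMass]
  congr 1
  refine lintegral_congr fun z => ?_
  rw [lintegral_prod]
  · simp only [piecewise_map_castSucc_snoc, absorbLast]
  · exact (((measurable_absorbLast hh).comp measurable_prodMk_left).enorm.pow_const p).aemeasurable

lemma tailIntegral_condMass_map_castSucc {h : (Fin (m + 1) → S) → T → B}
    (hh : Measurable (Function.uncurry h)) (J : Finset (Fin m)) (a : ℝ≥0∞) (t : ℝ) :
    tailIntegral (Measure.pi fun _ => μ)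
      (fun y => a * condMass p μ ν h (J.map Fin.castSuccEmb) y) q t =
      tailIntegral (Measure.pi fun _ => μ)
        (fun y => a * condMass p μ (μ.prod ν) (absorbLast h) J y) q t := by
  rw [← tailIntegral_comp (measurePreserving_snoc (μ := μ) m)
      ((measurable_condMass hh _).const_mul a),
    ← tailIntegral_comp (measurePreserving_fst (μ := Measure.pi fun _ : Fin m => μ) (ν := μ))
      ((measurable_condMass (measurable_absorbLast hh) J).const_mul a)]
  simp only [condMass_map_castSucc hh]

lemma measurable_condMass_freezeLast {h : (Fin (m + 1) → S) → T → B}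
    (hh : Measurable (Function.uncurry h)) (J : Finset (Fin m)) :
    Measurable fun z : S × (Fin m → S) => condMass p μ ν (freezeLast h z.1) J z.2 := by
  simp only [← condMass_insert_last hh]
  exact (measurable_condMass hh _).comp ((measurable_snoc m).comp measurable_swap)

lemma tailIntegral_condMass_insert_last {h : (Fin (m + 1) → S) → T → B}
    (hh : Measurable (Function.uncurry h)) (J : Finset (Fin m)) (a : ℝ≥0∞) (t : ℝ) :
    tailIntegral (Measure.pi fun _ => μ)
      (fun y => a * condMass p μ ν h (insert (Fin.last m) (J.map Fin.castSuccEmb)) y) q t =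
      ∫⁻ x, tailIntegral (Measure.pi fun _ => μ)
        (fun y => a * condMass p μ ν (freezeLast h x) J y) q t ∂μ := by
  have hsw : MeasurePreserving (fun z : S × (Fin m → S) =>
      (Fin.snoc (α := fun _ => S) z.2 z.1 : Fin (m + 1) → S))
      (μ.prod (Measure.pi fun _ => μ)) (Measure.pi fun _ => μ) :=
    (measurePreserving_snoc (μ := μ) m).comp Measure.measurePreserving_swap
  rw [← tailIntegral_comp hsw ((measurable_condMass hh _).const_mul a),
    lintegral_tailIntegral (Y := fun z : S × (Fin m → S) =>
      a * condMass p μ ν (freezeLast h z.1) J z.2)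
      ((measurable_condMass_freezeLast hh J).const_mul a)]
  simp only [condMass_insert_last hh]

/-- Recursion of the tail functional, splitting the subsets of variables according to whether
they contain the last one. -/
lemma tailBound_succ {h : (Fin (m + 1) → S) → T → B}
    (hh : Measurable (Function.uncurry h)) {N : ℕ} (hN : 1 ≤ N) (t : ℝ) :
    tailBound p q μ ν h N t =
      tailBound p q μ (μ.prod ν) (absorbLast h) N (t * ((N : ℝ) ^ (1 / p))⁻¹) +
        N * ∫⁻ x, tailBound p q μ ν (freezeLast h x) N t ∂μ := by
  have hN0 : (0 : ℝ) < N := by exact_mod_cast hN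
  have hNe : (N : ℝ≥0∞) ≠ 0 := by exact_mod_cast hN0.ne'
  rw [tailBound, sum_finset_fin_succ]
  congr 1
  · rw [tailBound]
    refine Finset.sum_congr rfl fun J _ => ?_
    -- The order has dropped by one while `J.card` has not, so the surplus factor `N ^ (1 / p)` is
    -- moved into the level.
    rw [Finset.card_map, ← tailIntegral_const_mul (by positivity),
      tailIntegral_condMass_map_castSucc hh]
    congr 2
    ext y
    rw [← mul_assoc]
    congr 1
    rw [← ENNReal.ofReal_rpow_of_pos hN0, ENNReal.ofReal_natCast,
      ← ENNReal.rpow_add _ _ hNe (by simp)]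
    congr 1
    push_cast
    ring
  · simp only [tailBound]
    have hmeas : ∀ J : Finset (Fin m), Measurable fun x => tailIntegral (Measure.pi fun _ => μ)
        (fun y => (N : ℝ≥0∞) ^ (((m : ℝ) - (J.card : ℝ)) / p) *
          condMass p μ ν (freezeLast h x) J y) q t := fun J =>
      measurable_tailIntegral (Y := fun z : S × (Fin m → S) =>
        (N : ℝ≥0∞) ^ (((m : ℝ) - (J.card : ℝ)) / p) * condMass p μ ν (freezeLast h z.1) J z.2)
        ((measurable_condMass_freezeLast hh J).const_mul _) q t
    rw [lintegral_finsetSum _ fun J _ => (hmeas J).const_mul _, Finset.mul_sum]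
    refine Finset.sum_congr rfl fun J _ => ?_
    -- Order and cardinality both drop by one: the exponent of the normalisation is unchanged, and
    -- one factor `N` comes out in front.
    rw [lintegral_const_mul _ (hmeas J), tailIntegral_condMass_insert_last hh,
      Finset.card_insert_of_notMem (by simp), Finset.card_map, ← mul_assoc, ← pow_succ']
    have : ((m + 1 : ℕ) : ℝ) - ((J.card + 1 : ℕ) : ℝ) = (m : ℝ) - J.card := by
      push_cast
      ring
    rw [this]

lemma DegenerateKernel.freezeLast {h : (Fin (m + 1) → S) → T → B} (hd : DegenerateKernel μ ν h) :
    ∀ᵐ x ∂μ, DegenerateKernel μ ν (freezeLast h x) := by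
  unfold DegenerateKernel
  rw [ae_all_iff]
  intro l
  have h1 := (measurePreserving_snoc_left (μ := μ) (ν := ν) m).quasiMeasurePreserving.ae
    (hd l.castSucc)
  filter_upwards [Measure.ae_ae_of_ae_prod h1] with x hx
  filter_upwards [hx] with z hz
  simpa [_root_.freezeLast, Fin.snoc_update] using hz

lemma DegenerateKernel.absorbLast {h : (Fin (m + 1) → S) → T → B} (hd : DegenerateKernel μ ν h) :
    DegenerateKernel μ (μ.prod ν) (absorbLast h) := by
  intro l
  have h1 := (measurePreserving_snoc_assoc (μ := μ) (ν := ν) m).quasiMeasurePreserving.ae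
    (hd l.castSucc)
  filter_upwards [h1] with z hz
  simpa [_root_.absorbLast, Fin.snoc_update] using hz

/-- Updating the last coordinate erases its former value, so Fubini and any single `x` from a set of
full measure suffice. -/
lemma DegenerateKernel.ae_integral_snoc {h : (Fin (m + 1) → S) → T → B}
    (hd : DegenerateKernel μ ν h) :
    ∀ᵐ z ∂((Measure.pi fun _ => μ).prod ν),
      Integrable (fun x => h (Fin.snoc (α := fun _ => S) z.1 x) z.2) μ ∧
        ∫ x, h (Fin.snoc (α := fun _ => S) z.1 x) z.2 ∂μ = 0 := by
  have h1 := (measurePreserving_snoc_left (μ := μ) (ν := ν) m).quasiMeasurePreserving.ae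
    (hd (Fin.last m))
  obtain ⟨x, hx⟩ := (Measure.ae_ae_of_ae_prod h1).exists
  filter_upwards [hx] with z hz
  simpa [Fin.update_snoc_last] using hz

end Kernel

/-! ### The deviation inequality for degenerate kernels -/

/-- Iteration of a recursive inequality between the values of `F` at `t` and at `t / 2`. -/
lemma le_two_mul_of_recursive_le {F H : ℝ → ℝ≥0∞} {ε a b : ℝ≥0∞} (hF1 : ∀ t, F t ≤ 1)
    (hF : ∀ t, 0 < t → F t ≤ ε * F (t / 2) + a * H t) (hH : ∀ t, 0 < t → H (t / 2) ≤ b * H t)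
    (hε : ε ≤ 2⁻¹) (hεb : ε * b ≤ 2⁻¹) {t : ℝ} (ht : 0 < t) : F t ≤ 2 * a * H t := by
  -- The error starts at one because `F ≤ 1`, and `ε ≤ 2⁻¹` halves it at every use of the recursion;
  -- `ε * b ≤ 2⁻¹` keeps the main constant at `2 * a`.
  have key : ∀ j : ℕ, ∀ t, 0 < t → F t ≤ 2 * a * H t + 2⁻¹ ^ j := by
    intro j
    induction j with
    | zero => intro t _; simpa using (hF1 t).trans le_add_self
    | succ j ih =>
      intro t ht
      calc F t ≤ ε * F (t / 2) + a * H t := hF t ht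
        _ ≤ ε * (2 * a * (b * H t) + 2⁻¹ ^ j) + a * H t := by
          gcongr
          refine (ih (t / 2) (by positivity)).trans ?_
          gcongr
          exact hH t ht
        _ = (ε * b) * (2 * (a * H t)) + ε * 2⁻¹ ^ j + a * H t := by ring
        _ ≤ 2⁻¹ * (2 * (a * H t)) + 2⁻¹ * 2⁻¹ ^ j + a * H t := by gcongr
        _ = 2 * a * H t + 2⁻¹ ^ (j + 1) := by
          rw [← mul_assoc, ENNReal.inv_mul_cancel (by simp) (by simp), one_mul, pow_succ']
          ring
  have hlim : Filter.Tendsto (fun j : ℕ => 2 * a * H t + (2⁻¹ : ℝ≥0∞) ^ j) Filter.atTop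
      (nhds (2 * a * H t + 0)) :=
    Filter.Tendsto.const_add _ (ENNReal.tendsto_pow_atTop_nhds_zero_of_lt_one (by simp))
  rw [add_zero] at hlim
  exact ge_of_tendsto' hlim fun j => key j t ht

section Induction

variable {Ω S T B : Type*} [mΩ : MeasurableSpace Ω] [mS : MeasurableSpace S]
  [mT : MeasurableSpace T]
  [NormedAddCommGroup B] [NormedSpace ℝ B] [CompleteSpace B]
  [TopologicalSpace.SeparableSpace B] [MeasurableSpace B] [BorelSpace B]
  {P : Measure Ω} [IsProbabilityMeasure P] {ξ : ℕ → Ω → S} {ν : Measure T}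
  [IsProbabilityMeasure ν] {p q : ℝ} {m : ℕ}

/-- The increments of the `U`-statistic with kernel `h`, as functions of the past, of the new
variable and of the parameter. -/
def uIncrement (ξ : ℕ → Ω → S) (h : (Fin (m + 1) → S) → T → B) (k : ℕ) (ω : Ω) (x : S)
    (τ : T) : B :=
  uStat ξ (fun y => freezeLast h x y τ) k ω

lemma uStat_eq_sum_uIncrement (h : (Fin (m + 1) → S) → T → B) (n : ℕ) (ω : Ω) (τ : T) :
    uStat ξ (fun y => h y τ) n ω = ∑ k ∈ Finset.range n, uIncrement ξ h k ω (ξ k ω) τ :=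
  uStat_eq_sum_range ξ (fun y => h y τ) n ω

lemma measurable_pastSigma_pi (ξ : ℕ → Ω → S) {k : ℕ} (i : Fin m ↪o Fin k) :
    Measurable[pastSigma ξ k] fun ω l => ξ (i l) ω :=
  @measurable_pi_lambda _ _ _ (pastSigma ξ k) _ _ fun l => measurable_pastSigma ξ (i l).2

lemma dependsOnPast_uIncrement {h : (Fin (m + 1) → S) → T → B}
    (hh : Measurable (Function.uncurry h)) : DependsOnPast ξ (uIncrement ξ h) := by
  intro k
  refine Finset.measurable_sum _ fun i _ => ?_
  have h1 : @Measurable (Ω × S × T) (S × (Fin m → S) × T) ((pastSigma ξ k).prod (mS.prod mT)) _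
      (fun z => (z.2.1, (fun l => ξ (i l) z.1), z.2.2)) := by
    refine Measurable.prodMk (measurable_fst.comp measurable_snd)
      (Measurable.prodMk ?_ (measurable_snd.comp measurable_snd))
    exact (measurable_pastSigma_pi ξ i).comp measurable_fst
  exact (measurable_freezeLast hh).comp h1

/-- The variables selected by a tuple have the product law, so the exceptional null set of the
kernel pulls back to a null set, and the summands vanish one by one. -/
lemma ae_integral_uIncrement (hξ : IsIID P ξ) {h : (Fin (m + 1) → S) → T → B}
    (hd : DegenerateKernel (P.map (ξ 0)) ν h) (k : ℕ) :
    ∀ᵐ z ∂(P.prod ν), ∫ x, uIncrement ξ h k z.1 x z.2 ∂(P.map (ξ 0)) = 0 := by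
  have : IsProbabilityMeasure (P.map (ξ 0)) :=
    Measure.isProbabilityMeasure_map (hξ.measurable 0).aemeasurable
  have h1 : ∀ i : Fin m ↪o Fin k, ∀ᵐ z ∂(P.prod ν),
      Integrable (fun x => freezeLast h x (fun l => ξ (i l) z.1) z.2) (P.map (ξ 0)) ∧
        ∫ x, freezeLast h x (fun l => ξ (i l) z.1) z.2 ∂(P.map (ξ 0)) = 0 := by
    intro i
    have hmp := (hξ.measurePreserving_of_injective (i := fun l => ((i l : Fin k) : ℕ))
      (Fin.val_injective.comp i.injective)).prod (MeasurePreserving.id ν)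
    exact hmp.quasiMeasurePreserving.ae hd.ae_integral_snoc
  filter_upwards [ae_all_iff.2 h1] with z hz
  simp only [uIncrement, uStat]
  rw [integral_finsetSum _ fun i _ => (hz i).1]
  exact Finset.sum_eq_zero fun i _ => (hz i).2

/-- The new variable is independent of the past, so it can be frozen at `x` and averaged afterwards.
-/
lemma DependsOnPast.measure_lpMass_apply (hξ : IsIID P ξ) {g : ℕ → Ω → S → T → B}
    (hg : DependsOnPast ξ g) (v : ℝ≥0∞) (k : ℕ) :
    P {ω | v < lpMass p ν (g k ω (ξ k ω))} =
      ∫⁻ x, P {ω | v < lpMass p ν (g k ω x)} ∂(P.map (ξ 0)) := by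
  have : IsProbabilityMeasure (P.map (ξ 0)) :=
    Measure.isProbabilityMeasure_map (hξ.measurable 0).aemeasurable
  have hL : Measurable[(pastSigma ξ k).prod mS] fun z : Ω × S => lpMass p ν (g k z.1 z.2) :=
    (measurable_id.pow_const (1 / p)).comp
      (hg.measurable_lintegral_enorm (ν := ν) (p := p) k)
  set I : ℝ≥0∞ → ℝ≥0∞ := (Set.Ioi v).indicator fun _ => 1 with hI
  have hIm : Measurable I := measurable_const.indicator measurableSet_Ioi
  have hG := lintegral_indep (hξ.pastSigma_le k) (hξ.measurable k) (hξ.indep_pastSigma k)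
    (G := fun ω x => I (lpMass p ν (g k ω x))) (hIm.comp hL)
  have hL' : Measurable fun z : Ω × S => lpMass p ν (g k z.1 z.2) :=
    hL.mono (hξ.pastSigma_prod_le k) le_rfl
  have hset : ∀ f : Ω → ℝ≥0∞, Measurable f → ∫⁻ ω, I (f ω) ∂P = P {ω | v < f ω} := by
    intro f hf
    have : (fun ω => I (f ω)) = {ω | v < f ω}.indicator fun _ => 1 := by
      ext ω; simp [hI, Set.indicator_apply]
    rw [this, lintegral_indicator (measurableSet_lt measurable_const hf)]
    simp
  rw [hset (fun ω => lpMass p ν (g k ω (ξ k ω)))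
    (hL'.comp (measurable_id.prodMk (hξ.measurable k))), hξ.map_eq,
    lintegral_lintegral_swap (f := fun ω x => I (lpMass p ν (g k ω x)))
      (hIm.comp hL').aemeasurable] at hG
  rw [hG]
  exact lintegral_congr fun x => hset _ (hL'.comp measurable_prodMk_right)

lemma exists_lt_of_lt_sum {V : ℕ → ℝ≥0∞} {N : ℕ} {v : ℝ≥0∞}
    (h : v < ∑ k ∈ Finset.range N, V k) : ∃ k < N, v < N * V k := by
  by_contra! hcon
  have hN : N ≠ 0 := by rintro rfl; simp at h
  have h1 : (N : ℝ≥0∞) * ∑ k ∈ Finset.range N, V k ≤ N * v := by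
    rw [Finset.mul_sum]
    refine (Finset.sum_le_sum fun k hk => hcon k (Finset.mem_range.1 hk)).trans ?_
    simp
  rw [ENNReal.mul_le_mul_iff_right (by exact_mod_cast hN) (by simp)] at h1
  exact absurd h (not_lt.2 h1)

/-- A term of the predictable variation is the `p`-th power of the norm of a lower-order statistic
whose parameter has absorbed the new variable. -/
lemma lintegral_uIncrement_eq (hp : 1 < p) {h : (Fin (m + 1) → S) → T → B}
    (hh : Measurable (Function.uncurry h)) {μ : Measure S} [IsProbabilityMeasure μ]
    (k : ℕ) (ω : Ω) :
    ∫⁻ x, ∫⁻ τ, ‖uIncrement ξ h k ω x τ‖ₑ ^ p ∂ν ∂μ =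
      lpMass p (μ.prod ν) (fun z => uStat ξ (fun y => absorbLast h y z) k ω) ^ p := by
  rw [lpMass_rpow hp, lintegral_prod]
  · rfl
  · refine Measurable.aemeasurable (Measurable.pow_const (Measurable.enorm ?_) p)
    exact Finset.measurable_sum _ fun i _ => (measurable_absorbLast hh).comp measurable_prodMk_left

/-- If the variation is large, one of its `N` terms exceeds the average; taking `p`-th roots turns
the factor `N` into the rescaling of the level by `N ^ (1 / p)`. -/
lemma measure_lt_sum_uIncrement_le (hp : 1 < p) {h : (Fin (m + 1) → S) → T → B}
    (hh : Measurable (Function.uncurry h)) {μ : Measure S} [IsProbabilityMeasure μ]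
    {N : ℕ} (hN : 1 ≤ N) {v : ℝ} (hv : 0 < v) :
    P {ω | ENNReal.ofReal v ^ p < ∑ k ∈ Finset.range N,
        ∫⁻ x, ∫⁻ τ, ‖uIncrement ξ h k ω x τ‖ₑ ^ p ∂ν ∂μ} ≤
      P {ω | ∃ n ≤ N, ENNReal.ofReal (v * ((N : ℝ) ^ (1 / p))⁻¹) <
        lpMass p (μ.prod ν) fun z => uStat ξ (fun y => absorbLast h y z) n ω} := by
  refine measure_mono fun ω hω => ?_
  obtain ⟨k, hk, hlt⟩ := exists_lt_of_lt_sum hω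
  refine ⟨k, hk.le, ?_⟩
  rw [lintegral_uIncrement_eq hp hh] at hlt
  have hp0 : 0 < p := by linarith
  have hN0 : (0 : ℝ) < N := by exact_mod_cast hN
  have hNp : 0 < (N : ℝ) ^ (1 / p) := by positivity
  have h1 : (N : ℝ≥0∞) = ENNReal.ofReal ((N : ℝ) ^ (1 / p)) ^ p := by
    rw [ENNReal.ofReal_rpow_of_pos hNp, ← Real.rpow_mul hN0.le, one_div_mul_cancel hp0.ne',
      Real.rpow_one, ENNReal.ofReal_natCast]
  rw [h1, ← ENNReal.mul_rpow_of_nonneg _ _ hp0.le, ENNReal.rpow_lt_rpow_iff hp0] at hlt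
  have h2 : ENNReal.ofReal v = ENNReal.ofReal ((N : ℝ) ^ (1 / p)) *
      ENNReal.ofReal (v * ((N : ℝ) ^ (1 / p))⁻¹) := by
    rw [← ENNReal.ofReal_mul hNp.le]
    congr 1
    field_simp
  rw [h2, ENNReal.mul_lt_mul_iff_right (by simpa using hNp) (by simp)] at hlt
  exact hlt

end Induction

lemma condMass_order_zero {S T B : Type*} [MeasurableSpace S] [MeasurableSpace T]
    [NormedAddCommGroup B] {μ : Measure S} [IsProbabilityMeasure μ] {ν : Measure T} {p : ℝ}
    (h : (Fin 0 → S) → T → B) (J : Finset (Fin 0)) (y : Fin 0 → S) :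
    condMass p μ ν h J y = lpMass p ν (h y) := by
  have h1 : ∀ z, J.piecewise y z = y := fun z => Subsingleton.elim _ _
  simp [condMass, lpMass, h1]

/-- The good-`λ` inequality for `U`-statistics, in terms of a bound for kernels of lower order. -/
lemma IsSmoothGauge.uStat_good_lambda {Ω S T B : Type*} [MeasurableSpace Ω] [MeasurableSpace S]
    [MeasurableSpace T] [NormedAddCommGroup B] [NormedSpace ℝ B] [CompleteSpace B]
    [TopologicalSpace.SeparableSpace B] [MeasurableSpace B] [BorelSpace B]
    {p q C : ℝ} (hp : 1 < p) {φ : B → ℝ} (hφ : IsSmoothGauge p C φ) {m : ℕ} {K : ℝ≥0}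
    {P : Measure Ω} [IsProbabilityMeasure P] {ν : Measure T} [IsProbabilityMeasure ν]
    {ξ : ℕ → Ω → S} (hξ : IsIID P ξ) {h : (Fin (m + 1) → S) → T → B}
    (hh : Measurable (Function.uncurry h)) (hd : DegenerateKernel (P.map (ξ 0)) ν h)
    {N : ℕ} (hN : 1 ≤ N)
    (hfreeze : ∀ᵐ x ∂(P.map (ξ 0)), ∀ v : ℝ, 0 < v →
      P {ω | ∃ n ≤ N, ENNReal.ofReal v <
        lpMass p ν fun τ => uStat ξ (fun y => freezeLast h x y τ) n ω} ≤
        K * tailBound p q (P.map (ξ 0)) ν (freezeLast h x) N v)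
    (habsorb : ∀ v : ℝ, 0 < v →
      P {ω | ∃ n ≤ N, ENNReal.ofReal v <
        lpMass p ((P.map (ξ 0)).prod ν) fun z => uStat ξ (fun y => absorbLast h y z) n ω} ≤
        K * tailBound p q (P.map (ξ 0)) ((P.map (ξ 0)).prod ν) (absorbLast h) N v)
    {δ : ℝ} (hδ0 : 0 < δ) (hδ : 2 * δ ≤ 1) {t : ℝ} (ht : 0 < t) :
    P {ω | ∃ n ≤ N, ENNReal.ofReal (2 * t) <
        lpMass p ν fun τ => uStat ξ (fun y => h y τ) n ω} ≤
      ENNReal.ofReal (C * (2 * δ) ^ p) *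
        P {ω | ∃ n ≤ N, ENNReal.ofReal t < lpMass p ν fun τ => uStat ξ (fun y => h y τ) n ω} +
      K * tailBound p q (P.map (ξ 0)) ν h N (δ * t) := by
  have hprob : IsProbabilityMeasure (P.map (ξ 0)) :=
    Measure.isProbabilityMeasure_map (hξ.measurable 0).aemeasurable
  have hg := dependsOnPast_uIncrement (ξ := ξ) hh
  have hgl := hφ.good_lambda hp hξ hg (ae_integral_uIncrement hξ hd)
    (t := t.toNNReal) (δ := δ.toNNReal) (by simpa using ht) (by
      rw [← NNReal.coe_le_coe]; simpa [hδ0.le] using hδ) N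
  have hδt : ((δ.toNNReal : ℝ≥0∞) * (t.toNNReal : ℝ≥0∞)) = ENNReal.ofReal (δ * t) := by
    rw [ENNReal.ofReal_mul hδ0.le]; rfl
  have h2t : 2 * (t.toNNReal : ℝ≥0∞) = ENNReal.ofReal (2 * t) := by
    rw [ENNReal.ofReal_mul (by norm_num)]; simp [ENNReal.ofReal]
  have h2δ : ENNReal.ofReal C * (2 * (δ.toNNReal : ℝ≥0∞)) ^ p =
      ENNReal.ofReal (C * (2 * δ) ^ p) := by
    rw [ENNReal.ofReal_mul hφ.const_pos.le, ← ENNReal.ofReal_rpow_of_pos (by positivity),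
      ENNReal.ofReal_mul (by norm_num)]
    simp [ENNReal.ofReal]
  have htt : (t.toNNReal : ℝ≥0∞) = ENNReal.ofReal t := rfl
  rw [hδt, h2t, h2δ, htt] at hgl
  simp only [uStat_eq_sum_uIncrement]
  refine hgl.trans (add_le_add le_rfl ?_)
  have hδt0 : 0 < δ * t := by positivity
  -- The absorbed part pays for the variation event, and the frozen part, with its factor `N`, for
  -- the union over single increments.
  rw [tailBound_succ hh hN, mul_add, add_comm]
  refine add_le_add ?_ ?_
  · refine (measure_lt_sum_uIncrement_le hp hh hN hδt0).trans (habsorb _ ?_)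
    have : (0 : ℝ) < N := by exact_mod_cast hN
    positivity
  · have h1 : ∀ k ∈ Finset.range N,
        P {ω | ENNReal.ofReal (δ * t) < lpMass p ν (uIncrement ξ h k ω (ξ k ω))} ≤
          K * ∫⁻ x, tailBound p q (P.map (ξ 0)) ν (freezeLast h x) N (δ * t) ∂(P.map (ξ 0)) := by
      intro k hk
      rw [hg.measure_lpMass_apply hξ, ← lintegral_const_mul' _ _ (by simp)]
      refine lintegral_mono_ae ?_
      filter_upwards [hfreeze] with x hx
      refine le_trans (measure_mono fun ω hω => ?_) (hx _ hδt0)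
      exact ⟨k, (Finset.mem_range.1 hk).le, hω⟩
    refine (Finset.sum_le_sum h1).trans ?_
    simp only [Finset.sum_const, Finset.card_range, nsmul_eq_mul]
    rw [mul_left_comm]

universe u v w

/-- The deviation inequality for `U`-statistics with a degenerate kernel depending on a
parameter. -/
theorem IsSmoothGauge.exists_tail_bound {B : Type w} [NormedAddCommGroup B] [NormedSpace ℝ B]
    [CompleteSpace B] [TopologicalSpace.SeparableSpace B] [MeasurableSpace B] [BorelSpace B]
    {p q C : ℝ} (hp : 1 < p) (hq : 0 < q) {φ : B → ℝ} (hφ : IsSmoothGauge p C φ) (m : ℕ) :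
    ∃ K : ℝ≥0, ∀ (Ω : Type u) (S T : Type v) [MeasurableSpace Ω] [MeasurableSpace S]
      [MeasurableSpace T] (P : Measure Ω) [IsProbabilityMeasure P] (ν : Measure T)
      [IsProbabilityMeasure ν] (ξ : ℕ → Ω → S) (h : (Fin m → S) → T → B),
      IsIID P ξ → Measurable (Function.uncurry h) → DegenerateKernel (P.map (ξ 0)) ν h →
      ∀ N : ℕ, 1 ≤ N → ∀ t : ℝ, 0 < t →
        P {ω | ∃ n ≤ N, ENNReal.ofReal t < lpMass p ν fun τ => uStat ξ (fun y => h y τ) n ω} ≤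
          K * tailBound p q (P.map (ξ 0)) ν h N t := by
  induction m with
  | zero =>
    refine ⟨q.toNNReal, fun Ω S T _ _ _ P _ ν _ ξ h hξ hh hd N hN t ht => ?_⟩
    have hprob : IsProbabilityMeasure (P.map (ξ 0)) :=
      Measure.isProbabilityMeasure_map (hξ.measurable 0).aemeasurable
    set y₀ : Fin 0 → S := Fin.elim0
    have hu : ∀ n ω τ, uStat ξ (fun y => h y τ) n ω = h y₀ τ := fun n ω τ =>
      uStat_order_zero ξ _ n ω y₀
    simp only [hu]
    -- In order zero the statistic is deterministic, so its event is empty or everything; in the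
    -- latter case the tail integral equals `1 / q`, hence the constant `q`.
    by_cases hlt : ENNReal.ofReal t < lpMass p ν (h y₀)
    · refine prob_le_one.trans ((one_le_mul_tailIntegral (P := Measure.pi fun _ => P.map (ξ 0))
        (Y := fun y => lpMass p ν (h y)) hq ht fun y => ?_).trans ?_)
      · rwa [Subsingleton.elim y y₀]
      · have h1 : ENNReal.ofReal q = (q.toNNReal : ℝ≥0∞) := rfl
        rw [h1]
        gcongr
        rw [tailBound]
        refine le_trans ?_ (Finset.single_le_sum (fun _ _ => zero_le) (Finset.mem_univ ∅))
        simp [condMass_order_zero]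
    · simp [hlt]
  | succ m ih =>
    obtain ⟨K, hK⟩ := ih
    have hC := hφ.const_pos
    -- The contraction factor must beat the growth `2 ^ q` of `tailBound` under halving of `t`, with
    -- a factor `2⁻¹` to spare.
    obtain ⟨δ, hδ0, hδ1, hδ⟩ : ∃ δ : ℝ, 0 < δ ∧ 2 * δ ≤ 1 ∧
        C * (2 * δ) ^ p ≤ (2 : ℝ) ^ (-q) * 2⁻¹ := by
      set s := min 1 ((2 : ℝ) ^ (-q) * 2⁻¹ / C) with hs
      have hs0 : 0 < s := by positivity
      have hs1 : s ≤ 1 := min_le_left _ _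
      refine ⟨s / 2, by positivity, by linarith, ?_⟩
      have h1 : (2 * (s / 2)) ^ p ≤ s := by
        rw [mul_div_cancel₀ s two_ne_zero]
        calc s ^ p ≤ s ^ (1 : ℝ) := Real.rpow_le_rpow_of_exponent_ge hs0 hs1 hp.le
          _ = s := Real.rpow_one s
      calc C * (2 * (s / 2)) ^ p ≤ C * s := by gcongr
        _ ≤ C * ((2 : ℝ) ^ (-q) * 2⁻¹ / C) := by gcongr; exact min_le_right _ _
        _ = _ := by field_simp
    -- The power of `δ / 2` is the cost of raising the level from `δ * (t / 2)` to `t`; the `2`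
    -- comes from the iteration.
    refine ⟨2 * (K * ((δ / 2) ^ (-q)).toNNReal), fun Ω S T _ _ _ P _ ν _ ξ h hξ hh hd N hN => ?_⟩
    have hprob : IsProbabilityMeasure (P.map (ξ 0)) :=
      Measure.isProbabilityMeasure_map (hξ.measurable 0).aemeasurable
    intro t ht
    have h2 : (2 : ℝ≥0∞)⁻¹ = ENNReal.ofReal 2⁻¹ := by
      rw [ENNReal.ofReal_inv_of_pos two_pos]; simp
    have h2q : (2 : ℝ) ^ (-q) ≤ 1 :=
      Real.rpow_le_one_of_one_le_of_nonpos (by norm_num) (by linarith)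
    push_cast
    refine le_two_mul_of_recursive_le
      (F := fun t => P {ω | ∃ n ≤ N, ENNReal.ofReal t <
        lpMass p ν fun τ => uStat ξ (fun y => h y τ) n ω})
      (H := tailBound p q (P.map (ξ 0)) ν h N) (ε := ENNReal.ofReal (C * (2 * δ) ^ p))
      (b := ENNReal.ofReal ((2⁻¹ : ℝ) ^ (-q))) (fun t => prob_le_one) ?_ ?_ ?_ ?_ ht
    · intro t ht
      have hstep := hφ.uStat_good_lambda (q := q) hp hξ hh hd hN (K := K)
        (by
          filter_upwards [hd.freezeLast] with x hx
          exact hK Ω S T P ν ξ _ hξ (measurable_uncurry_freezeLast hh x) hx N hN)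
        (hK Ω S (S × T) P _ ξ _ hξ (measurable_absorbLast hh) hd.absorbLast N hN)
        hδ0 hδ1 (half_pos ht)
      rw [mul_div_cancel₀ t two_ne_zero] at hstep
      refine hstep.trans (add_le_add le_rfl ?_)
      rw [mul_assoc]
      gcongr
      have h3 : δ * (t / 2) = (δ / 2) * t := by ring
      rw [h3]
      exact tailBound_mul_le h N (by positivity) (by linarith)
    · intro t ht
      have h3 : t / 2 = 2⁻¹ * t := by ring
      rw [h3]
      exact tailBound_mul_le h N (by norm_num) (by norm_num)
    · rw [h2]
      refine ENNReal.ofReal_le_ofReal (hδ.trans ?_)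
      nlinarith
    · rw [h2, ← ENNReal.ofReal_mul (by positivity)]
      refine ENNReal.ofReal_le_ofReal ?_
      have h4 : (2 : ℝ) ^ (-q) * (2⁻¹ : ℝ) ^ (-q) = 1 := by
        rw [← Real.mul_rpow (by norm_num) (by norm_num)]; norm_num
      calc C * (2 * δ) ^ p * (2⁻¹ : ℝ) ^ (-q) ≤ (2 : ℝ) ^ (-q) * 2⁻¹ * (2⁻¹ : ℝ) ^ (-q) := by gcongr
        _ = ((2 : ℝ) ^ (-q) * (2⁻¹ : ℝ) ^ (-q)) * 2⁻¹ := by ring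
        _ ≤ 2⁻¹ := by rw [h4, one_mul]

/-! ### Conditional expectations given some of the variables -/

section Conditional

variable {Ω S B : Type*} [mΩ : MeasurableSpace Ω] [mS : MeasurableSpace S]
  [NormedAddCommGroup B] [NormedSpace ℝ B] [CompleteSpace B]
  [TopologicalSpace.SeparableSpace B] [MeasurableSpace B] [BorelSpace B]
  {P : Measure Ω} [IsProbabilityMeasure P] {ξ : ℕ → Ω → S} {m : ℕ}

lemma IsIID.measurePreserving_firstVars (hξ : IsIID P ξ) (m : ℕ) :
    MeasurePreserving (firstVars m ξ) P (Measure.pi fun _ => P.map (ξ 0)) :=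
  hξ.measurePreserving_of_injective Fin.val_injective

lemma IsIID.sigmaOf_le (hξ : IsIID P ξ) (J : Finset (Fin m)) : sigmaOf ξ J ≤ mΩ :=
  (measurable_pi_iff.2 fun _ => hξ.measurable _).comap_le

/-- Glue a vector indexed by `J` and the complementary entries of another vector. -/
def glue (J : Finset (Fin m)) (z : (J → S) × (Fin m → S)) : Fin m → S :=
  fun l => if hl : l ∈ J then z.1 ⟨l, hl⟩ else z.2 l

lemma measurable_glue (J : Finset (Fin m)) : Measurable (glue (S := S) J) := by
  refine measurable_pi_iff.2 fun l => ?_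
  by_cases hl : l ∈ J
  · simpa [glue, hl] using (measurable_pi_apply (⟨l, hl⟩ : J)).fun_comp measurable_fst
  · simpa [glue, hl] using (measurable_pi_apply l).fun_comp measurable_snd

lemma glue_restrict (J : Finset (Fin m)) (y z : Fin m → S) :
    glue J (fun j : J => y j, z) = J.piecewise y z := by
  ext l
  by_cases hl : l ∈ J <;> simp [glue, hl]

lemma measurableSet_restrict_preimage {J : Finset (Fin m)} {A : Set (J → S)}
    (hA : MeasurableSet A) : MeasurableSet {y : Fin m → S | (fun j : J => y j) ∈ A} :=
  (measurable_pi_iff.2 fun j : J => measurable_pi_apply (j : Fin m) :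
    Measurable fun (y : Fin m → S) (j : J) => y j) hA

/-- Independence turns conditioning on `ξ_J` into integrating out the other coordinates. The test
events depend on the coordinates in `J` only, so resampling the rest does not affect them. -/
lemma IsIID.condLExp_sigmaOf (hξ : IsIID P ξ) {F : (Fin m → S) → ℝ≥0∞} (hF : Measurable F)
    (J : Finset (Fin m)) :
    P⁻[fun ω => F (firstVars m ξ ω) | sigmaOf ξ J] =ᵐ[P]
      fun ω => ∫⁻ z, F (J.piecewise (firstVars m ξ ω) z) ∂(Measure.pi fun _ => P.map (ξ 0)) := by
  have hprob : IsProbabilityMeasure (P.map (ξ 0)) :=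
    Measure.isProbabilityMeasure_map (hξ.measurable 0).aemeasurable
  set μ := P.map (ξ 0) with hμ
  have hmp := hξ.measurePreserving_firstVars m
  rw [← hμ] at hmp
  have hFJ : Measurable fun y : Fin m → S =>
      ∫⁻ z, F (J.piecewise y z) ∂(Measure.pi fun _ : Fin m => μ) :=
    measurable_lintegral_param (hF.comp (measurable_piecewise J))
  refine (ae_eq_condLExp (hξ.sigmaOf_le J) P _ ?_ ?_).symm
  · have h1 : Measurable fun a : J → S =>
        ∫⁻ z, F (glue J (a, z)) ∂(Measure.pi fun _ : Fin m => μ) :=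
      measurable_lintegral_param (hF.comp (measurable_glue J))
    have h2 := h1.comp (comap_measurable fun (ω : Ω) (j : J) => ξ (j : Fin m) ω)
    convert h2 using 1
    ext ω
    exact lintegral_congr fun z => congrArg F (glue_restrict J (firstVars m ξ ω) z).symm
  · rintro _ ⟨A, hA, rfl⟩
    set E := {y : Fin m → S | (fun j : J => y j) ∈ A} with hE
    have hEm : MeasurableSet E := measurableSet_restrict_preimage hA
    have hpre : (fun (ω : Ω) (j : J) => ξ (j : Fin m) ω) ⁻¹' A = firstVars m ξ ⁻¹' E := rfl
    have hEJ : ∀ y z, (J.piecewise y z ∈ E) = (y ∈ E) := by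
      intro y z
      have : (fun j : J => J.piecewise y z j) = fun j : J => y j := by
        ext j; simp
      simp only [hE, Set.mem_ofPred_eq, this]
    have hind : Measurable (E.indicator F) := hF.indicator hEm
    rw [hpre, hmp.setLIntegral_comp_preimage hEm hFJ, hmp.setLIntegral_comp_preimage hEm hF,
      ← lintegral_indicator hEm, ← lintegral_indicator hEm,
      ← (measurePreserving_piecewise (μ := μ) J).lintegral_comp hind,
      lintegral_prod (fun z : (Fin m → S) × (Fin m → S) => E.indicator F (J.piecewise z.1 z.2))
        (hind.comp (measurable_piecewise J)).aemeasurable]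
    refine lintegral_congr fun y => ?_
    by_cases hy : y ∈ E
    · simp [hEJ, hy]
    · simp [hEJ, hy]

/-- The partial integral over coordinate `l` is a version of the conditional expectation given the
others, so it vanishes almost surely, and this transfers to the law of the variables. -/
lemma IsDegenerated.ae_integral_update (hξ : IsIID P ξ) {h : (Fin m → S) → B} (hh : Measurable h)
    (hd : IsDegenerated P ξ h) (l : Fin m) :
    ∀ᵐ y ∂(Measure.pi fun _ => P.map (ξ 0)),
      Integrable (fun x => h (Function.update y l x)) (P.map (ξ 0)) ∧
        ∫ x, h (Function.update y l x) ∂(P.map (ξ 0)) = 0 := by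
  have hprob : IsProbabilityMeasure (P.map (ξ 0)) :=
    Measure.isProbabilityMeasure_map (hξ.measurable 0).aemeasurable
  set μ := P.map (ξ 0) with hμ
  have hmp := hξ.measurePreserving_firstVars m
  rw [← hμ] at hmp
  have hup := measurePreserving_update (μ := μ) l
  have hint : Integrable h (Measure.pi fun _ => μ) :=
    (hmp.integrable_comp hh.aestronglyMeasurable).1 hd.1
  have hint2 : Integrable (fun z : (Fin m → S) × S => h (Function.update z.1 l z.2))
      ((Measure.pi fun _ => μ).prod μ) := (hup.integrable_comp hh.aestronglyMeasurable).2 hint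
  set J : Finset (Fin m) := Finset.univ \ {l} with hJ
  set d : (Fin m → S) → B := fun y => ∫ x, h (Function.update y l x) ∂μ with hd_def
  have hdm : StronglyMeasurable d :=
    (hh.comp (measurable_update_pair l)).stronglyMeasurable.integral_prod_right'
  have hdint : Integrable d (Measure.pi fun _ => μ) := hint2.integral_prod_left
  have hdcond : (fun ω => d (firstVars m ξ ω)) =ᵐ[P]
      P[fun ω => h (firstVars m ξ ω) | sigmaOf ξ J] := by
    have hdi : Integrable (fun ω => d (firstVars m ξ ω)) P :=
      (hmp.integrable_comp hdm.aestronglyMeasurable).2 hdint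
    refine ae_eq_condExp_of_forall_setIntegral_eq (hξ.sigmaOf_le J) hd.1
      (fun s _ _ => hdi.integrableOn) ?_ ?_
    · rintro _ ⟨A, hA, rfl⟩ -
      set E := {y : Fin m → S | (fun j : J => y j) ∈ A} with hE
      have hEm : MeasurableSet E := measurableSet_restrict_preimage hA
      have hpre : (fun (ω : Ω) (j : J) => ξ (j : Fin m) ω) ⁻¹' A = firstVars m ξ ⁻¹' E := rfl
      have hEJ : ∀ y x, (Function.update y l x ∈ E) = (y ∈ E) := by
        intro y x
        have : (fun j : J => Function.update y l x j) = fun j : J => y j := by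
          ext j
          have hj := j.2
          simp only [hJ, Finset.mem_sdiff, Finset.mem_singleton] at hj
          simp [hj.2]
        simp only [hE, Set.mem_ofPred_eq, this]
      have hmap : ∀ f : (Fin m → S) → B, StronglyMeasurable f →
          ∫ ω in firstVars m ξ ⁻¹' E, f (firstVars m ξ ω) ∂P =
            ∫ y in E, f y ∂(Measure.pi fun _ => μ) := by
        intro f hf
        rw [← hmp.map_eq, setIntegral_map hEm hf.aestronglyMeasurable hmp.measurable.aemeasurable]
      rw [hpre, hmap d hdm, hmap h hh.stronglyMeasurable, ← integral_indicator hEm,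
        ← integral_indicator hEm]
      have hindm : StronglyMeasurable (E.indicator h) := hh.stronglyMeasurable.indicator hEm
      have hswap : ∫ y, E.indicator h y ∂(Measure.pi fun _ => μ) =
          ∫ z, E.indicator h (Function.update z.1 l z.2) ∂((Measure.pi fun _ => μ).prod μ) := by
        rw [← hup.map_eq, integral_map hup.measurable.aemeasurable hindm.aestronglyMeasurable,
          hup.map_eq]
      rw [hswap, integral_prod
        (fun z : (Fin m → S) × S => E.indicator h (Function.update z.1 l z.2)) ((hup.integrable_comp hindm.aestronglyMeasurable).2
        (hint.indicator hEm))]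
      refine integral_congr_ae (ae_of_all _ fun y => ?_)
      by_cases hy : y ∈ E
      · simp [hEJ, hy, hd_def]
      · simp [hEJ, hy]
    -- Only the index `l` lies outside `J`, so a constant vector can supply the missing coordinate.
    · have h1 : StronglyMeasurable fun a : J → S => ∫ x, h (glue J (a, fun _ => x)) ∂μ :=
        StronglyMeasurable.integral_prod_right' (f := fun z : (J → S) × S =>
          h (glue J (z.1, fun _ => z.2))) (hh.comp ((measurable_glue J).comp
            (measurable_fst.prodMk (measurable_pi_iff.2 fun _ => measurable_snd)))).stronglyMeasurable
      have h2 := h1.comp_measurable (comap_measurable fun (ω : Ω) (j : J) => ξ (j : Fin m) ω)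
      refine StronglyMeasurable.aestronglyMeasurable ?_
      convert h2 using 1
      ext ω
      refine integral_congr_ae (ae_of_all _ fun x => congrArg h ?_)
      refine Eq.trans ?_ (glue_restrict J (firstVars m ξ ω) fun _ => x).symm
      ext k
      by_cases hk : k = l
      · subst hk; simp [hJ]
      · simp [hJ, hk]
  have hzero : ∀ᵐ ω ∂P, d (firstVars m ξ ω) = 0 := hdcond.trans (hd.2 l)
  have hzero' : ∀ᵐ y ∂(Measure.pi fun _ => μ), d y = 0 := by
    rw [← hmp.map_eq]
    exact (ae_map_iff hmp.measurable.aemeasurable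
      (hdm.measurable (measurableSet_singleton 0))).2 hzero
  filter_upwards [hint2.prod_right_ae, hzero'] with y h1 h2 using ⟨h1, h2⟩

end Conditional

/-! ### The deviation inequality -/

section Main

lemma sum_finset_eq_univ_add_empty_add {m : ℕ} (hm : 1 ≤ m) (f : Finset (Fin m) → ℝ≥0∞) :
    ∑ J, f J = f Finset.univ +
      (f ∅ + ∑ J : Finset (Fin m) with J.Nonempty ∧ J ≠ Finset.univ, f J) := by
  have hne : (∅ : Finset (Fin m)) ≠ Finset.univ := by
    have : Nonempty (Fin m) := ⟨⟨0, hm⟩⟩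
    exact Finset.univ_nonempty.ne_empty.symm
  have hsplit : (Finset.univ : Finset (Finset (Fin m))) = insert Finset.univ
      (insert ∅ (Finset.univ.filter fun J : Finset (Fin m) => J.Nonempty ∧ J ≠ Finset.univ)) := by
    ext J
    simp only [Finset.mem_univ, Finset.mem_insert, Finset.mem_filter, true_and, true_iff,
      Finset.nonempty_iff_ne_empty]
    tauto
  conv_lhs => rw [hsplit]
  rw [Finset.sum_insert (by simp [hne.symm]), Finset.sum_insert (by simp)]

lemma lpMass_const {T B : Type*} [MeasurableSpace T] [NormedAddCommGroup B] {p : ℝ} (hp : 1 < p)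
    (ν : Measure T) [IsProbabilityMeasure ν] (b : B) : lpMass p ν (fun _ => b) = ‖b‖ₑ := by
  simp [lpMass, ← ENNReal.rpow_mul, mul_inv_cancel₀ (by linarith : p ≠ 0)]

variable {Ω S T B : Type*} [mΩ : MeasurableSpace Ω] [mS : MeasurableSpace S]
  [mT : MeasurableSpace T] [NormedAddCommGroup B] [NormedSpace ℝ B]
  [TopologicalSpace.SeparableSpace B] [MeasurableSpace B] [BorelSpace B]
  {P : Measure Ω} [IsProbabilityMeasure P] {ξ : ℕ → Ω → S} {ν : Measure T}
  [IsProbabilityMeasure ν] {m : ℕ} {p q t : ℝ}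

lemma condMass_const (h : (Fin m → S) → B) (J : Finset (Fin m)) (μ : Measure S) (y : Fin m → S) :
    condMass p μ ν (fun y _ => h y) J y =
      (∫⁻ z, ‖h (J.piecewise y z)‖ₑ ^ p ∂(Measure.pi fun _ => μ)) ^ (1 / p) := by
  simp [condMass]

/-- The tail functional of a parameter-free kernel, in terms of conditional expectations. -/
lemma IsIID.tailIntegral_condMass (hξ : IsIID P ξ) {h : (Fin m → S) → B} (hh : Measurable h)
    (J : Finset (Fin m)) (a : ℝ≥0∞) :
    tailIntegral (Measure.pi fun _ => P.map (ξ 0))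
      (fun y => a * condMass p (P.map (ξ 0)) ν (fun y _ => h y) J y) q t =
      tailIntegral P (fun ω => a *
        (P⁻[fun ω' => ‖h (firstVars m ξ ω')‖ₑ ^ p | sigmaOf ξ J] ω) ^ (1 / p)) q t := by
  have hprob : IsProbabilityMeasure (P.map (ξ 0)) :=
    Measure.isProbabilityMeasure_map (hξ.measurable 0).aemeasurable
  rw [← tailIntegral_comp (hξ.measurePreserving_firstVars m)
    ((measurable_condMass (h := fun y _ => h y) (hh.comp measurable_fst) J).const_mul a)]
  refine tailIntegral_congr_ae ?_ q t
  filter_upwards [hξ.condLExp_sigmaOf (hh.enorm.pow_const p) J] with ω hω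
  rw [hω, condMass_const]

lemma IsIID.tailIntegral_condMass_univ (hp : 1 < p) (hξ : IsIID P ξ) {h : (Fin m → S) → B}
    (hh : Measurable h) :
    tailIntegral (Measure.pi fun _ => P.map (ξ 0))
      (fun y => condMass p (P.map (ξ 0)) ν (fun y _ => h y) Finset.univ y) q t =
      tailIntegral P (fun ω => ‖h (firstVars m ξ ω)‖ₑ) q t := by
  have hprob : IsProbabilityMeasure (P.map (ξ 0)) :=
    Measure.isProbabilityMeasure_map (hξ.measurable 0).aemeasurable
  rw [← tailIntegral_comp (hξ.measurePreserving_firstVars m)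
    (measurable_condMass (h := fun y _ => h y) (hh.comp measurable_fst) _)]
  congr 1
  ext ω
  rw [condMass_const]
  simp [← ENNReal.rpow_mul, mul_inv_cancel₀ (by linarith : p ≠ 0)]

/-- Conditioning on no variable leaves a deterministic quantity, whose tail integral is of moment
type. -/
lemma IsIID.tailIntegral_condMass_empty_le (hq : 0 < q) (ht : 0 < t) (hξ : IsIID P ξ)
    {h : (Fin m → S) → B} (hh : Measurable h) (N : ℕ) :
    tailIntegral (Measure.pi fun _ => P.map (ξ 0))
      (fun y => (N : ℝ≥0∞) ^ ((m : ℝ) / p) *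
        condMass p (P.map (ξ 0)) ν (fun y _ => h y) ∅ y) q t ≤
      ENNReal.ofReal (1 / q) * (ENNReal.ofReal (t ^ (-q)) * (N : ℝ≥0∞) ^ ((m : ℝ) * q / p) *
        (∫⁻ ω, ‖h (firstVars m ξ ω)‖ₑ ^ p ∂P) ^ (q / p)) := by
  have hprob : IsProbabilityMeasure (P.map (ξ 0)) :=
    Measure.isProbabilityMeasure_map (hξ.measurable 0).aemeasurable
  simp only [condMass_const, Finset.piecewise_empty]
  refine (tailIntegral_const_le _ hq ht).trans (le_of_eq ?_)
  rw [(hξ.measurePreserving_firstVars m).lintegral_comp (hh.enorm.pow_const p),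
    ENNReal.mul_rpow_of_nonneg _ _ hq.le, ← ENNReal.rpow_mul, ← ENNReal.rpow_mul, mul_assoc]
  have h1 : (m : ℝ) / p * q = m * q / p := by ring
  have h2 : 1 / p * q = q / p := by ring
  rw [h1, h2]

end Main

end

theorem mainTheorem2
    {B : Type*} [NormedAddCommGroup B] [NormedSpace ℝ B] [CompleteSpace B]
    [TopologicalSpace.SeparableSpace B] [MeasurableSpace B] [BorelSpace B]
    (m : ℕ) (hm : 1 ≤ m) (p q : ℝ) (hp : 1 < p) (hq : 0 < q) :
    ∃ K : ℝ≥0, 0 < K ∧ ∀ r : ℝ, 1 < r → r ≤ 2 → p ≤ r → IsRSmooth r B →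
      ∀ {Ω S : Type*} [MeasurableSpace Ω] [MeasurableSpace S]
        (P : Measure Ω) [IsProbabilityMeasure P] (ξ : ℕ → Ω → S) (h : (Fin m → S) → B),
        IsIID P ξ → Measurable h → IsDegenerated P ξ h →
        ∀ t : ℝ, 0 < t → ∀ N : ℕ, m ≤ N →
          P {ω | ENNReal.ofReal t < ⨆ n ∈ Finset.Icc m N, ‖uStat ξ h n ω‖ₑ} ≤
            K * (N : ℝ≥0∞) ^ m *
                tailIntegral P (fun ω => ‖h (firstVars m ξ ω)‖ₑ) q t
            + K * ∑ J : Finset (Fin m) with J.Nonempty ∧ J ≠ Finset.univ,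
                (N : ℝ≥0∞) ^ J.card *
                  tailIntegral P
                    (fun ω => (N : ℝ≥0∞) ^ (((m : ℝ) - (J.card : ℝ)) / p) *
                      (P⁻[fun ω' => ‖h (firstVars m ξ ω')‖ₑ ^ p | sigmaOf ξ J] ω) ^ (1 / p))
                    q t
            + K * ENNReal.ofReal (t ^ (-q)) * (N : ℝ≥0∞) ^ ((m : ℝ) * q / p) *
                (∫⁻ ω, ‖h (firstVars m ξ ω)‖ₑ ^ p ∂P) ^ (q / p) := by
  -- The constant must be chosen before `r`. Existence of a gauge involves only `p` and `B`, and if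
  -- there is none then no admissible `r` exists.
  by_cases hsm : ∃ (C : ℝ) (φ : B → ℝ), IsSmoothGauge p C φ
  swap
  · exact ⟨1, one_pos, fun r _ hr2 hpr hr => absurd (hr.exists_isSmoothGauge hp hpr hr2) hsm⟩
  obtain ⟨C, φ, hφ⟩ := hsm
  obtain ⟨K₀, hK₀⟩ := hφ.exists_tail_bound hp hq m
  -- The summand `K₀` serves the nonempty `J`, `K₀ / q` serves `J = ∅`, and `1` ensures positivity.
  set K : ℝ≥0 := K₀ + K₀ * (1 / q).toNNReal + 1 with hK
  have hKK : (K₀ : ℝ≥0∞) ≤ K := by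
    rw [hK]; exact_mod_cast (le_add_of_nonneg_right zero_le).trans
      (le_add_of_nonneg_right zero_le)
  have hKq : (K₀ : ℝ≥0∞) * ENNReal.ofReal (1 / q) ≤ K := by
    have h1 : ENNReal.ofReal (1 / q) = ((1 / q).toNNReal : ℝ≥0∞) := rfl
    rw [hK, h1]
    exact_mod_cast (le_add_of_nonneg_left zero_le).trans (le_add_of_nonneg_right zero_le)
  refine ⟨K, by positivity, ?_⟩
  intro r _ _ _ _ Ω S _ _ P _ ξ h hξ hh hd t ht N hmN
  have hprob : IsProbabilityMeasure (P.map (ξ 0)) :=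
    Measure.isProbabilityMeasure_map (hξ.measurable 0).aemeasurable
  -- Over a one-point parameter space the `L^p` norm is the norm of `B`.
  set ν : Measure PUnit := Measure.dirac PUnit.unit
  have hdeg : DegenerateKernel (P.map (ξ 0)) ν (fun y _ => h y) := fun l =>
    (measurePreserving_fst (μ := Measure.pi fun _ : Fin m => P.map (ξ 0))
      (ν := ν)).quasiMeasurePreserving.ae (hd.ae_integral_update hξ hh l)
  have hmain := hK₀ Ω S PUnit P ν ξ (fun y _ => h y) hξ (hh.comp measurable_fst) hdeg N
    (hm.trans hmN) t ht
  have hsub : {ω | ENNReal.ofReal t < ⨆ n ∈ Finset.Icc m N, ‖uStat ξ h n ω‖ₑ} ⊆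
      {ω | ∃ n ≤ N, ENNReal.ofReal t < lpMass p ν fun _ => uStat ξ h n ω} := by
    intro ω hω
    simp only [Set.mem_ofPred_eq, lt_iSup_iff] at hω
    obtain ⟨n, hn, hlt⟩ := hω
    exact ⟨n, (Finset.mem_Icc.1 hn).2, by rwa [lpMass_const hp]⟩
  refine (measure_mono hsub).trans (hmain.trans ?_)
  rw [tailBound, sum_finset_eq_univ_add_empty_add hm, mul_add, mul_add]
  have hU : (K₀ : ℝ≥0∞) * ((N : ℝ≥0∞) ^ (Finset.univ : Finset (Fin m)).card *
      tailIntegral (Measure.pi fun _ => P.map (ξ 0)) (fun y =>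
        (N : ℝ≥0∞) ^ (((m : ℝ) - ((Finset.univ : Finset (Fin m)).card : ℝ)) / p) *
          condMass p (P.map (ξ 0)) ν (fun y _ => h y) Finset.univ y) q t) ≤
      K * (N : ℝ≥0∞) ^ m * tailIntegral P (fun ω => ‖h (firstVars m ξ ω)‖ₑ) q t := by
    rw [← hξ.tailIntegral_condMass_univ (ν := ν) hp hh, mul_assoc]
    simp only [Finset.card_univ, Fintype.card_fin, sub_self, zero_div, ENNReal.rpow_zero, one_mul]
    gcongr
  have hE : (K₀ : ℝ≥0∞) * ((N : ℝ≥0∞) ^ (∅ : Finset (Fin m)).card *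
      tailIntegral (Measure.pi fun _ => P.map (ξ 0)) (fun y =>
        (N : ℝ≥0∞) ^ (((m : ℝ) - ((∅ : Finset (Fin m)).card : ℝ)) / p) *
          condMass p (P.map (ξ 0)) ν (fun y _ => h y) ∅ y) q t) ≤
      K * ENNReal.ofReal (t ^ (-q)) * (N : ℝ≥0∞) ^ ((m : ℝ) * q / p) *
        (∫⁻ ω, ‖h (firstVars m ξ ω)‖ₑ ^ p ∂P) ^ (q / p) := by
    simp only [Finset.card_empty, pow_zero, one_mul, Nat.cast_zero, sub_zero]
    refine (mul_le_mul_right (hξ.tailIntegral_condMass_empty_le hq ht hh N) _).trans ?_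
    rw [← mul_assoc, mul_assoc (K : ℝ≥0∞), mul_assoc (K : ℝ≥0∞)]
    gcongr
  have hJ : ∀ J : Finset (Fin m), (K₀ : ℝ≥0∞) * ((N : ℝ≥0∞) ^ J.card *
      tailIntegral (Measure.pi fun _ => P.map (ξ 0)) (fun y =>
        (N : ℝ≥0∞) ^ (((m : ℝ) - (J.card : ℝ)) / p) *
          condMass p (P.map (ξ 0)) ν (fun y _ => h y) J y) q t) ≤
      K * ((N : ℝ≥0∞) ^ J.card * tailIntegral P
        (fun ω => (N : ℝ≥0∞) ^ (((m : ℝ) - (J.card : ℝ)) / p) *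
          (P⁻[fun ω' => ‖h (firstVars m ξ ω')‖ₑ ^ p | sigmaOf ξ J] ω) ^ (1 / p)) q t) := by
    intro J
    rw [hξ.tailIntegral_condMass hh]
    gcongr
  rw [add_assoc]
  refine (add_le_add hU (add_le_add hE ?_)).trans_eq (congrArg _ (add_comm _ _))
  rw [Finset.mul_sum, Finset.mul_sum]
  exact Finset.sum_le_sum fun J _ => hJ J
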